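/- Let $(X,g)$ be a complete (connected, smooth) Riemannian manifold of dimension $n+1$, let $\Omega\subset X$ be an open set, not necessarily bounded, with smooth boundary $\partial\Omega$, and let $\beta:\partial\Omega\to\mathbb{R}$ be smooth. Write $dV$ and $dS$ for the volume element of $X$ and the area element of $\partial\Omega$, $V$ for the volume, $R$ for the scalar curvature and $Rm$ for the Riemann tensor of $g$. For $\tau>0$ and a smooth function $f:\bar\Omega\to\mathbb{R}$ put $u=e^{-f}/(4\pi\tau)^{\frac{n+1}{2}}$, $$\mathcal{W}_\beta(\Omega,g,f,\tau)=\int_\Omega\left(\tau(|\nabla f|^2+R)+f-(n+1)\right)u\,dV+2\tau\int_{\partial\Omega}\beta u\,dS,$$ $$\mathcal{W}_\beta(\Omega,f,\tau)=\int_\Omega\left(\tau|\nabla f|^2+f-(n+1)\right)u\,dV+2\tau\int_{\partial\Omega}\beta u\,dS,$$ and let $\mu_\beta(\Omega,g,\tau)$ and $\mu_\beta(\Omega,\tau)$ in $[-\infty,\infty]$ be the infima of $\mathcal{W}_\beta(\Omega,g,f,\tau)$, respectively of $\mathcal{W}_\beta(\Omega,f,\tau)$, over all smooth $f:\bar\Omega\to\mathbb{R}$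 with $\int_\Omega u\,dV=1$ for which all the terms $u$, $|\nabla f|^2u$, $fu$ (and, for the first infimum, $Ru$) are integrable on $\Omega$ and $\beta u$ is integrable on $\partial\Omega$. Suppose that for some constants $c_1$ and $c_2$ there is a sequence of balls $B_{r_k}(x_k)\subset X$, $r_k>0$, such that for all $k$ one has $V(\Omega\cap B_{r_k/2}(x_k))>0$, $$\frac{V(\Omega\cap B_{r_k}(x_k))+r_k^2\int_{\partial\Omega\cap B_{r_k}(x_k)}|\beta|\,dS}{V(\Omega\cap B_{r_k/2}(x_k))}\le c_1,$$ $r_k^2|Rm|\le c_2$ in $\Omega\cap B_{r_k}(x_k)$, and such that $$\frac{V(\Omega\cap B_{r_k}(x_k))}{r_k^{n+1}}\to 0\quad\text{as }k\to\infty.$$ Then $$\inf_{\tau>0}\mu_\beta(\Omega,g,\tau)=-\infty\qquad\text{and}\qquad\inf_{\tau>0}\mu_\beta(\Omega,\tau)=-\infty.$$ -/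

import Mathlib

open Set Filter Topology MeasureTheory Bundle
open scoped Manifold ContDiff ENNReal

noncomputable section

namespace RegionEntropy

/-! ### The Levi-Civita connection and the curvature tensor in coordinates -/

section Coordinates

variable {E : Type*} [NormedAddCommGroup E] [NormedSpace ℝ E]

/-- The Christoffel symbols `Γ_y(u, v)` of a metric `G` on (an open subset of) a vector space `E`,
characterised by
`G_y (Γ_y(u, v), z) = (1/2) (∂_u G (v, z) + ∂_v G (u, z) - ∂_z G (u, v))` for all `z`. -/
def christoffel (G : E → E →L[ℝ] E →L[ℝ] ℝ) (y u v : E) : E :=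
  (G y).inverse ((1 / 2 : ℝ) •
    (fderiv ℝ G y u v + fderiv ℝ G y v u - ((fderiv ℝ G y).flip u).flip v))

/-- The curvature operator `R(u, v) w = ∇_u ∇_v w - ∇_v ∇_u w` (for constant vector fields
`u, v, w` on `E`) of the Levi-Civita connection of `G`, at the point `y`. -/
def coordCurvature (G : E → E →L[ℝ] E →L[ℝ] ℝ) (y u v w : E) : E :=
  fderiv ℝ (fun y' => christoffel G y' v w) y u - fderiv ℝ (fun y' => christoffel G y' u w) y v
    + christoffel G y u (christoffel G y v w) - christoffel G y v (christoffel G y u w)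

end Coordinates

section Manifold

variable {n : ℕ} {X : Type*} [MetricSpace X] [ChartedSpace (EuclideanSpace ℝ (Fin (n + 1))) X]
  [IsManifold (𝓡 (n + 1)) ∞ X]
  [RiemannianBundle (fun x : X => TangentSpace (𝓡 (n + 1)) x)]

/-- The Riemannian metric of `X` written in the preferred chart at `p`, as a field of bilinear
forms on the model space: `(u, v) ↦ ⟪D u, D v⟫` with `D` the derivative of the inverse chart. -/
def chartMetric (p : X) (y : EuclideanSpace ℝ (Fin (n + 1))) :
    EuclideanSpace ℝ (Fin (n + 1)) →L[ℝ] EuclideanSpace ℝ (Fin (n + 1)) →L[ℝ] ℝ :=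
  (innerSL ℝ (E := TangentSpace (𝓡 (n + 1)) ((extChartAt (𝓡 (n + 1)) p).symm y))).bilinearComp
    (mfderiv 𝓘(ℝ, EuclideanSpace ℝ (Fin (n + 1))) (𝓡 (n + 1)) (extChartAt (𝓡 (n + 1)) p).symm y)
    (mfderiv 𝓘(ℝ, EuclideanSpace ℝ (Fin (n + 1))) (𝓡 (n + 1)) (extChartAt (𝓡 (n + 1)) p).symm y)

/-- The Riemann tensor `Rm_p(u, v, w, z) = ⟪R(u, v) w, z⟫`, computed in the preferred chart
at `p`. -/
def riemannTensor (p : X) (u v w z : TangentSpace (𝓡 (n + 1)) p) : ℝ :=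
  let D : TangentSpace (𝓡 (n + 1)) p → EuclideanSpace ℝ (Fin (n + 1)) :=
    mfderiv (𝓡 (n + 1)) 𝓘(ℝ, EuclideanSpace ℝ (Fin (n + 1))) (extChartAt (𝓡 (n + 1)) p) p
  chartMetric p (extChartAt (𝓡 (n + 1)) p p)
    (coordCurvature (chartMetric p) (extChartAt (𝓡 (n + 1)) p p) (D u) (D v) (D w)) (D z)

/-- An orthonormal basis of the tangent space at `p` with respect to the Riemannian metric. -/
def tangentFrame (n : ℕ) {X : Type*} [MetricSpace X]
    [ChartedSpace (EuclideanSpace ℝ (Fin (n + 1))) X]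
    [IsManifold (𝓡 (n + 1)) ∞ X] [RiemannianBundle (fun x : X => TangentSpace (𝓡 (n + 1)) x)]
    (p : X) : OrthonormalBasis (Fin (n + 1)) ℝ (TangentSpace (𝓡 (n + 1)) p) :=
  haveI : FiniteDimensional ℝ (TangentSpace (𝓡 (n + 1)) p) :=
    inferInstanceAs (FiniteDimensional ℝ (EuclideanSpace ℝ (Fin (n + 1))))
  (stdOrthonormalBasis ℝ (TangentSpace (𝓡 (n + 1)) p)).reindex
    (finCongr (finrank_euclideanSpace_fin (𝕜 := ℝ) (n := n + 1)))

/-- The norm `|Rm|` of the Riemann tensor at `p`. -/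
def riemannNorm (n : ℕ) {X : Type*} [MetricSpace X]
    [ChartedSpace (EuclideanSpace ℝ (Fin (n + 1))) X]
    [IsManifold (𝓡 (n + 1)) ∞ X] [RiemannianBundle (fun x : X => TangentSpace (𝓡 (n + 1)) x)]
    (p : X) : ℝ :=
  √(∑ i, ∑ j, ∑ k, ∑ l, (riemannTensor p (tangentFrame n p i) (tangentFrame n p j)
    (tangentFrame n p k) (tangentFrame n p l)) ^ 2)

/-- The scalar curvature `R` at `p` (positive on round spheres). -/
def scalarCurvature (n : ℕ) {X : Type*} [MetricSpace X]
    [ChartedSpace (EuclideanSpace ℝ (Fin (n + 1))) X]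
    [IsManifold (𝓡 (n + 1)) ∞ X] [RiemannianBundle (fun x : X => TangentSpace (𝓡 (n + 1)) x)]
    (p : X) : ℝ :=
  ∑ i, ∑ j, riemannTensor p (tangentFrame n p i) (tangentFrame n p j)
    (tangentFrame n p j) (tangentFrame n p i)

/-- The norm `|∇f|` at `p` of the gradient of `f` with respect to the Riemannian metric, i.e. the
length of the vector of derivatives of `f` in the directions of an orthonormal basis. -/
def gradNorm (n : ℕ) {X : Type*} [MetricSpace X]
    [ChartedSpace (EuclideanSpace ℝ (Fin (n + 1))) X]
    [IsManifold (𝓡 (n + 1)) ∞ X] [RiemannianBundle (fun x : X => TangentSpace (𝓡 (n + 1)) x)]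
    (f : X → ℝ) (p : X) : ℝ :=
  √(∑ i, (show ℝ from mfderiv (𝓡 (n + 1)) 𝓘(ℝ, ℝ) f p (tangentFrame n p i)) ^ 2)

/-- The open set `Ω` has smooth boundary: near every boundary point it is a strict sublevel set of
a smooth function without critical points. -/
def HasSmoothBoundary (n : ℕ) {X : Type*} [MetricSpace X]
    [ChartedSpace (EuclideanSpace ℝ (Fin (n + 1))) X] (Ω : Set X) : Prop :=
  ∀ p ∈ frontier Ω, ∃ U : Set X, IsOpen U ∧ p ∈ U ∧ ∃ φ : X → ℝ,
    ContMDiffOn (𝓡 (n + 1)) 𝓘(ℝ, ℝ) ∞ φ U ∧ (∀ q ∈ U, mfderiv (𝓡 (n + 1)) 𝓘(ℝ, ℝ) φ q ≠ 0) ∧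
    Ω ∩ U = {q ∈ U | φ q < 0}

end Manifold

/-! ### The entropy

The volume element `dV` is the `(n+1)`-dimensional Hausdorff measure of the Riemannian distance and
the area element `dS` on the boundary is the `n`-dimensional one, both normalised so as to agree
with Lebesgue measure on Euclidean space. -/

section Entropy

variable (n : ℕ) {X : Type*} [MetricSpace X] [MeasurableSpace X] [BorelSpace X]
  [ChartedSpace (EuclideanSpace ℝ (Fin (n + 1))) X] [IsManifold (𝓡 (n + 1)) ∞ X]
  [RiemannianBundle (fun x : X => TangentSpace (𝓡 (n + 1)) x)]

/-- `u = e^{-f} / (4πτ)^{(n+1)/2}`. -/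
def density (f : X → ℝ) (τ : ℝ) (x : X) : ℝ :=
  Real.exp (-f x) / (4 * Real.pi * τ) ^ (((n : ℝ) + 1) / 2)

/-- The functional
`∫_Ω (τ (|∇f|² + P) + f - (n+1)) u dV + 2 τ ∫_{∂Ω} β u dS`
with a potential `P`. -/
def entropyFunctional (P : X → ℝ) (β : X → ℝ) (Ω : Set X) (f : X → ℝ) (τ : ℝ) : ℝ :=
  (∫ x in Ω, (τ * (gradNorm n f x ^ 2 + P x) + f x - ((n : ℝ) + 1)) * density n f τ x
      ∂(μHE[n + 1] : Measure X))
    + 2 * τ * ∫ x in frontier Ω, β x * density n f τ x ∂(μHE[n] : Measure X)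

/-- The competitors: functions `f`, smooth on the closure of `Ω`, with `∫_Ω u dV = 1`, for which
each of the terms of the functional is integrable. -/
structure IsCompetitor (P : X → ℝ) (β : X → ℝ) (Ω : Set X) (τ : ℝ) (f : X → ℝ) : Prop where
  smooth : ContMDiffOn (𝓡 (n + 1)) 𝓘(ℝ, ℝ) ∞ f (closure Ω)
  integrable_density : IntegrableOn (density n f τ) Ω (μHE[n + 1] : Measure X)
  integral_density : ∫ x in Ω, density n f τ x ∂(μHE[n + 1] : Measure X) = 1
  integrable_grad :
    IntegrableOn (fun x => gradNorm n f x ^ 2 * density n f τ x) Ω (μHE[n + 1] : Measure X)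
  integrable_potential : IntegrableOn (fun x => P x * density n f τ x) Ω (μHE[n + 1] : Measure X)
  integrable_self : IntegrableOn (fun x => f x * density n f τ x) Ω (μHE[n + 1] : Measure X)
  integrable_boundary :
    IntegrableOn (fun x => β x * density n f τ x) (frontier Ω) (μHE[n] : Measure X)

/-- The infimum of the functional with potential `P` over all competitors, as an extended real. -/
def entropyWithPotential (P : X → ℝ) (β : X → ℝ) (Ω : Set X) (τ : ℝ) : EReal :=
  ⨅ (f : X → ℝ) (_ : IsCompetitor n P β Ω τ f), (entropyFunctional n P β Ω f τ : EReal)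

/-- The entropy `μ_β(Ω, g, τ)`, which involves the scalar curvature. -/
def metricEntropy (β : X → ℝ) (Ω : Set X) (τ : ℝ) : EReal :=
  entropyWithPotential n (scalarCurvature n) β Ω τ

/-- The entropy `μ_β(Ω, τ)`, without the scalar curvature. -/
def entropy (β : X → ℝ) (Ω : Set X) (τ : ℝ) : EReal :=
  entropyWithPotential n (fun _ => 0) β Ω τ

end Entropy

end RegionEntropy

end

/-! Fix a ball of radius `r` from the sequence and take `τ = r ^ 2`. Let `η` be a smooth cutoff
equal to 1 on the half ball and to 0 off the ball, with `r |∇η| ≤ C`. Formally one tests with `u =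
η² / Z`, where `Z` normalises the mass. Writing `f = L - log η²` with `L = log Z - (n+1)/2 · log (4π
r²)`, the functional splits into `L` plus an error. Since `|∇ log η²|² η² = 4 |∇η|²` and `s log s`
is bounded for `s` in `[0, 1]`, the error is at most a constant times `(V + r² ∫ |β|) / v + 1`, with
`V` and `v` the volumes in the ball and half ball. The ratio hypothesis and the curvature bound keep
it bounded along the sequence, while `L` is at most `log (2V / r^(n+1))`, which tends to `-∞` by
collapse.

A competitor must be a finite smooth function on all of `closure Ω`, so `u` may not vanish.
Therefore `η²` is replaced by `s = η² + w²`, with `w > 0` smooth and so small that its integrals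
against `dV`, `|P| dV` and `|β| dS` are negligible compared with `v`. The estimate is
`exists_isCompetitor_le`; a general continuous potential `P` covers the entropies with and without
scalar curvature together.

The rest supplies the analysis. Scalar curvature must be continuous for `w` to be chosen; it is
defined at each point in that point's own chart, so this needs the coordinate invariance of the
curvature tensor (`fderiv_coordCurvature`, `continuous_scalarCurvature`). Volume and boundary area
must be locally finite (`isLocallyFiniteMeasure_volume`, `isLocallyFiniteMeasure_area`). The cutoff
is built from a smooth approximation of the distance function with bounded gradient
(`exists_smoothing`, `exists_cutoff`), and `w` from a partition of unity (`exists_weight`). -/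

noncomputable section

set_option maxSynthPendingDepth 3
set_option linter.unusedSectionVars false

namespace RegionEntropy

/-! ### Christoffel symbols and curvature under changes of coordinates -/

section CoordinateMetric

variable {E : Type*} [NormedAddCommGroup E] [NormedSpace ℝ E]

/-- A smooth Riemannian metric on an open subset `S` of a vector space. -/
structure IsMetricOn (G : E → E →L[ℝ] E →L[ℝ] ℝ) (S : Set E) : Prop where
  isOpen : IsOpen S
  contDiffOn : ContDiffOn ℝ ∞ G S
  symm : ∀ y ∈ S, ∀ u v, G y u v = G y v u
  pos : ∀ y ∈ S, ∀ v, v ≠ 0 → 0 < G y v v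

/-- The lowered Christoffel symbols `(1/2) (∂_u G (v, z) + ∂_v G (u, z) - ∂_z G (u, v))`. -/
def loweredChristoffel (G : E → E →L[ℝ] E →L[ℝ] ℝ) (y : E) : E →L[ℝ] E →L[ℝ] E →L[ℝ] ℝ :=
  (1 / 2 : ℝ) • (fderiv ℝ G y + (fderiv ℝ G y).flip
    - ((ContinuousLinearMap.flipₗᵢ ℝ E E ℝ).toContinuousLinearEquiv.toContinuousLinearMap).comp
        (fderiv ℝ G y).flip)

/-- The Christoffel symbols as a field of continuous bilinear maps. -/
def christoffelMap (G : E → E →L[ℝ] E →L[ℝ] ℝ) (y : E) : E →L[ℝ] E →L[ℝ] E :=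
  (ContinuousLinearMap.compL ℝ E (E →L[ℝ] ℝ) E (G y).inverse).comp (loweredChristoffel G y)

/-- Differentiability of the operator-valued field lets evaluation at constant vectors commute with
the derivative. In this form the curvature is visibly trilinear, and the chain rule applies to it.
-/
theorem coordCurvature_eq {G : E → E →L[ℝ] E →L[ℝ] ℝ} {y : E}
    (h : DifferentiableAt ℝ (christoffelMap G) y) (u v w : E) :
    coordCurvature G y u v w = fderiv ℝ (christoffelMap G) y u v w
      - fderiv ℝ (christoffelMap G) y v u w
      + christoffelMap G y u (christoffelMap G y v w)
      - christoffelMap G y v (christoffelMap G y u w) := by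
  have key : ∀ a b : E, fderiv ℝ (fun y' => christoffel G y' a b) y
      = (((fderiv ℝ (christoffelMap G) y).flip a).flip b) := by
    intro a b
    have h1 : HasFDerivAt (fun y' => christoffelMap G y' a b)
        (((fderiv ℝ (christoffelMap G) y).flip a).flip b) y := by
      have h2 := (h.hasFDerivAt.clm_apply (hasFDerivAt_const a y)).clm_apply (hasFDerivAt_const b y)
      convert h2 using 1
      ext z
      simp
    exact h1.fderiv
  simp only [coordCurvature, key]
  rfl

variable [FiniteDimensional ℝ E]

namespace IsMetricOn

variable {G : E → E →L[ℝ] E →L[ℝ] ℝ} {S : Set E}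

theorem isInvertible (hG : IsMetricOn G S) {y : E} (hy : y ∈ S) : (G y).IsInvertible := by
  have hinj : Function.Injective (G y) := by
    rw [injective_iff_map_eq_zero]
    intro v hv
    by_contra h
    have := hG.pos y hy v h
    rw [hv] at this
    simp at this
  have hfin : Module.finrank ℝ E = Module.finrank ℝ (E →L[ℝ] ℝ) := by
    rw [← (LinearMap.toContinuousLinearMap (𝕜 := ℝ) (E := E) (F' := ℝ)).finrank_eq]
    exact (Subspace.dual_finrank_eq (K := ℝ) (V := E)).symm
  have : FiniteDimensional ℝ (E →L[ℝ] ℝ) :=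
    LinearEquiv.finiteDimensional LinearMap.toContinuousLinearMap
  let e := LinearEquiv.ofInjectiveOfFinrankEq (G y : E →ₗ[ℝ] (E →L[ℝ] ℝ)) hinj hfin
  refine ⟨e.toContinuousLinearEquiv, ?_⟩
  ext v w
  rfl

theorem apply_inverse (hG : IsMetricOn G S) {y : E} (hy : y ∈ S) (l : E →L[ℝ] ℝ) :
    G y ((G y).inverse l) = l := by
  obtain ⟨e, he⟩ := hG.isInvertible hy
  rw [← he, ContinuousLinearMap.inverse_equiv]
  simp

theorem injective (hG : IsMetricOn G S) {y : E} (hy : y ∈ S) : Function.Injective (G y) := by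
  obtain ⟨e, he⟩ := hG.isInvertible hy
  rw [← he]
  exact e.injective

theorem apply_christoffelMap (hG : IsMetricOn G S) {y : E} (hy : y ∈ S) (u v z : E) :
    G y (christoffelMap G y u v) z
      = (1 / 2 : ℝ) * (fderiv ℝ G y u v z + fderiv ℝ G y v u z - fderiv ℝ G y z u v) := by
  have : G y (christoffelMap G y u v) = loweredChristoffel G y u v := hG.apply_inverse hy _
  rw [this]
  rfl


theorem contDiffAt (hG : IsMetricOn G S) {y : E} (hy : y ∈ S) : ContDiffAt ℝ ∞ G y :=
  hG.contDiffOn.contDiffAt (hG.isOpen.mem_nhds hy)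

theorem contDiffAt_inverse (hG : IsMetricOn G S) {y : E} (hy : y ∈ S) :
    ContDiffAt ℝ ∞ (fun y => (G y).inverse) y :=
  (hG.isInvertible hy).contDiffAt_map_inverse.comp y (hG.contDiffAt hy)

theorem contDiffAt_christoffelMap (hG : IsMetricOn G S) {y : E} (hy : y ∈ S) :
    ContDiffAt ℝ ∞ (christoffelMap G) y := by
  have h1 : ContDiffAt ℝ ∞ (fderiv ℝ G) y := (hG.contDiffAt hy).fderiv_right le_rfl
  have h2 : ContDiffAt ℝ ∞ (fun y => (fderiv ℝ G y).flip) y :=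
    (ContinuousLinearMap.flipₗᵢ ℝ E E (E →L[ℝ] ℝ)).contDiff.contDiffAt.comp y h1
  have h3 : ContDiffAt ℝ ∞ (loweredChristoffel G) y := by
    refine contDiffAt_const (c := (1 / 2 : ℝ)).smul ((h1.add h2).sub ?_)
    exact contDiffAt_const.clm_comp h2
  exact ((ContinuousLinearMap.compL ℝ E (E →L[ℝ] ℝ) E).contDiff.contDiffAt.comp y
    (hG.contDiffAt_inverse hy)).clm_comp h3

/-- The transformation law of the Christoffel symbols under a change of coordinates. -/
theorem fderiv_christoffelMap {G' : E → E →L[ℝ] E →L[ℝ] ℝ} {S' : Set E} {φ : E → E}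
    (hG : IsMetricOn G S) (hG' : IsMetricOn G' S') (hφ : ContDiffOn ℝ ∞ φ S')
    (hmaps : MapsTo φ S' S) (hsurj : ∀ y ∈ S', Function.Surjective (fderiv ℝ φ y))
    (hpull : ∀ y ∈ S', ∀ u v, G' y u v = G (φ y) (fderiv ℝ φ y u) (fderiv ℝ φ y v))
    {y : E} (hy : y ∈ S') (u v : E) :
    fderiv ℝ φ y (christoffelMap G' y u v) = fderiv ℝ (fderiv ℝ φ) y u v
      + christoffelMap G (φ y) (fderiv ℝ φ y u) (fderiv ℝ φ y v) := by
  have hφy : ContDiffAt ℝ ∞ φ y := hφ.contDiffAt (hG'.isOpen.mem_nhds hy)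
  have hJ : ContDiffAt ℝ ∞ (fderiv ℝ φ) y := hφy.fderiv_right le_rfl
  have hφd : HasFDerivAt φ (fderiv ℝ φ y) y := (hφy.differentiableAt (by simp)).hasFDerivAt
  have hJd : HasFDerivAt (fderiv ℝ φ) (fderiv ℝ (fderiv ℝ φ) y) y :=
    (hJ.differentiableAt (by simp)).hasFDerivAt
  have hGd : HasFDerivAt G (fderiv ℝ G (φ y)) (φ y) :=
    ((hG.contDiffAt (hmaps hy)).differentiableAt (by simp)).hasFDerivAt
  have hG'd : HasFDerivAt G' (fderiv ℝ G' y) y :=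
    ((hG'.contDiffAt hy).differentiableAt (by simp)).hasFDerivAt
  have hsymm : ∀ a b, fderiv ℝ (fderiv ℝ φ) y a b = fderiv ℝ (fderiv ℝ φ) y b a := by
    intro a b
    exact (hφy.isSymmSndFDerivAt (n := ∞) (by simp; exact ENat.LEInfty.out)) a b
  have hGs := hG.symm (φ y) (hmaps hy)
  -- The derivative of the pullback identity. In the Koszul combination of three such identities,
  -- symmetry of `D²φ` and of `G` cancels every second-derivative term except the two equal ones
  -- containing `D²φ (u, v)`.
  have key : ∀ a b c, fderiv ℝ G' y a b c
      = fderiv ℝ G (φ y) (fderiv ℝ φ y a) (fderiv ℝ φ y b) (fderiv ℝ φ y c)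
        + G (φ y) (fderiv ℝ (fderiv ℝ φ) y a b) (fderiv ℝ φ y c)
        + G (φ y) (fderiv ℝ φ y b) (fderiv ℝ (fderiv ℝ φ) y a c) := by
    intro a b c
    have h1 := ((hG'd.clm_apply (hasFDerivAt_const b y)).clm_apply (hasFDerivAt_const c y))
    have h2 := (((hGd.comp y hφd).clm_apply (hJd.clm_apply (hasFDerivAt_const b y))).clm_apply
      (hJd.clm_apply (hasFDerivAt_const c y)))
    have h3 : (fun y => G' y b c) =ᶠ[𝓝 y]
        fun y => (G ∘ φ) y (fderiv ℝ φ y b) (fderiv ℝ φ y c) := by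
      filter_upwards [hG'.isOpen.mem_nhds hy] with z hz
      exact hpull z hz b c
    have h4 := (h1.congr_of_eventuallyEq h3.symm).unique h2
    have h5 := congrArg (fun L => L a) h4
    simp at h5
    rw [h5]
    ring
  apply hG.injective (hmaps hy)
  ext z
  obtain ⟨z, rfl⟩ := hsurj y hy z
  rw [map_add, add_apply, hG.apply_christoffelMap (hmaps hy), ← hpull y hy,
    hG'.apply_christoffelMap hy, key, key, key, hsymm v u, hsymm z u, hsymm z v,
    hGs _ (fderiv ℝ (fderiv ℝ φ) y u z), hGs _ (fderiv ℝ (fderiv ℝ φ) y v z)]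
  ring

/-- The curvature tensor is invariant under changes of coordinates. -/
theorem fderiv_coordCurvature {G' : E → E →L[ℝ] E →L[ℝ] ℝ} {S' : Set E} {φ : E → E}
    (hG : IsMetricOn G S) (hG' : IsMetricOn G' S') (hφ : ContDiffOn ℝ ∞ φ S')
    (hmaps : MapsTo φ S' S) (hsurj : ∀ y ∈ S', Function.Surjective (fderiv ℝ φ y))
    (hpull : ∀ y ∈ S', ∀ u v, G' y u v = G (φ y) (fderiv ℝ φ y u) (fderiv ℝ φ y v))
    {y : E} (hy : y ∈ S') (u v w : E) :
    fderiv ℝ φ y (coordCurvature G' y u v w)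
      = coordCurvature G (φ y) (fderiv ℝ φ y u) (fderiv ℝ φ y v) (fderiv ℝ φ y w) := by
  have hφy : ContDiffAt ℝ ∞ φ y := hφ.contDiffAt (hG'.isOpen.mem_nhds hy)
  have hJ : ContDiffAt ℝ ∞ (fderiv ℝ φ) y := hφy.fderiv_right le_rfl
  have hH : ContDiffAt ℝ ∞ (fderiv ℝ (fderiv ℝ φ)) y := hJ.fderiv_right le_rfl
  have hφd : HasFDerivAt φ (fderiv ℝ φ y) y := (hφy.differentiableAt (by simp)).hasFDerivAt
  have hJd : HasFDerivAt (fderiv ℝ φ) (fderiv ℝ (fderiv ℝ φ) y) y :=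
    (hJ.differentiableAt (by simp)).hasFDerivAt
  have hHd := (hH.differentiableAt (by simp)).hasFDerivAt
  have hC := (hG.contDiffAt_christoffelMap (hmaps hy)).differentiableAt (by simp)
  have hC' := (hG'.contDiffAt_christoffelMap hy).differentiableAt (by simp)
  have hsymm : ∀ a b, fderiv ℝ (fderiv ℝ φ) y a b = fderiv ℝ (fderiv ℝ φ) y b a := by
    intro a b
    exact (hφy.isSymmSndFDerivAt (n := ∞) (by simp; exact ENat.LEInfty.out)) a b
  have hsymm3 : ∀ a b, fderiv ℝ (fderiv ℝ (fderiv ℝ φ)) y a b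
      = fderiv ℝ (fderiv ℝ (fderiv ℝ φ)) y b a := by
    intro a b
    exact (hJ.isSymmSndFDerivAt (n := ∞) (by simp; exact ENat.LEInfty.out)) a b
  have law : ∀ z ∈ S', ∀ a b, fderiv ℝ φ z (christoffelMap G' z a b)
      = fderiv ℝ (fderiv ℝ φ) z a b
      + christoffelMap G (φ z) (fderiv ℝ φ z a) (fderiv ℝ φ z b) :=
    fun z hz a b => hG.fderiv_christoffelMap hG' hφ hmaps hsurj hpull hz a b
  -- The transformation law differentiated once more.
  have key : ∀ a b c, fderiv ℝ (fderiv ℝ φ) y a (christoffelMap G' y b c)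
      + fderiv ℝ φ y (fderiv ℝ (christoffelMap G') y a b c)
      = fderiv ℝ (fderiv ℝ (fderiv ℝ φ)) y a b c
        + fderiv ℝ (christoffelMap G) (φ y) (fderiv ℝ φ y a) (fderiv ℝ φ y b) (fderiv ℝ φ y c)
        + christoffelMap G (φ y) (fderiv ℝ (fderiv ℝ φ) y a b) (fderiv ℝ φ y c)
        + christoffelMap G (φ y) (fderiv ℝ φ y b) (fderiv ℝ (fderiv ℝ φ) y a c) := by
    intro a b c
    have h1 := hJd.clm_apply
      ((hC'.hasFDerivAt.clm_apply (hasFDerivAt_const b y)).clm_apply (hasFDerivAt_const c y))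
    have h2 := ((hHd.clm_apply (hasFDerivAt_const b y)).clm_apply (hasFDerivAt_const c y)).add
      (((hC.hasFDerivAt.comp y hφd).clm_apply (hJd.clm_apply (hasFDerivAt_const b y))).clm_apply
        (hJd.clm_apply (hasFDerivAt_const c y)))
    have h3 := (h1.congr_of_eventuallyEq (EventuallyEq.symm ?_)).unique h2
    · have h5 := congrArg (fun L => L a) h3
      simp at h5
      rw [add_comm, h5]
      abel
    · filter_upwards [hG'.isOpen.mem_nhds hy] with z hz
      exact law z hz b c
  rw [coordCurvature_eq hC, coordCurvature_eq hC']
  simp only [map_add, map_sub]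
  rw [law y hy, law y hy, law y hy, law y hy]
  -- Antisymmetrising in `u, v` removes the third derivatives of `φ`. The remaining
  -- second-derivative terms cancel against those produced by `law` in the quadratic Christoffel
  -- terms.
  have k1 := key u v w
  have k2 := key v u w
  rw [hsymm3 v u, hsymm v u] at k2
  have e1 := eq_sub_of_add_eq' k1
  have e2 := eq_sub_of_add_eq' k2
  rw [e1, e2]
  simp only [map_add]
  abel

/-! ### Metric traces and continuity of the scalar curvature in coordinates -/

section Trace

variable {y : E} {ι κ : Type*} [Fintype ι] [Fintype κ] [DecidableEq ι] {ε : ι → E}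

/-- The inverse metric is `∑ εᵢ ⊗ εᵢ`. Since `tangentFrame` is chosen pointwise and need not be
continuous, this is what rewrites frame sums as expressions continuous in the point. -/
theorem inverse_eq_sum_orthonormal (hG : IsMetricOn G S) (hy : y ∈ S)
    (hcard : Fintype.card ι = Module.finrank ℝ E)
    (horth : ∀ i j, G y (ε i) (ε j) = if i = j then 1 else 0) (l : E →L[ℝ] ℝ) :
    (G y).inverse l = ∑ i, l (ε i) • ε i := by
  have hli : LinearIndependent ℝ ε := by
    rw [Fintype.linearIndependent_iff]
    intro g hg i
    have h1 := congrArg (fun v => G y v (ε i)) hg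
    simpa [horth] using h1
  let B := basisOfLinearIndependentOfCardEqFinrank' ε hli hcard
  have hB : ∀ i, B i = ε i := fun i => by
    simp [B]
  apply hG.injective hy
  rw [hG.apply_inverse hy]
  apply ContinuousLinearMap.coe_injective
  refine B.ext fun j => ?_
  simp [hB, horth]

/-- The squared norm of a covector, computed in an orthonormal basis. -/
theorem sum_sq_orthonormal (hG : IsMetricOn G S) (hy : y ∈ S)
    (hcard : Fintype.card ι = Module.finrank ℝ E)
    (horth : ∀ i j, G y (ε i) (ε j) = if i = j then 1 else 0) (l : E →L[ℝ] ℝ) :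
    ∑ i, l (ε i) ^ 2 = l ((G y).inverse l) := by
  rw [hG.inverse_eq_sum_orthonormal hy hcard horth]
  simp [pow_two]

/-- The metric trace of a bilinear form, computed in an orthonormal basis or in any basis. -/
theorem sum_orthonormal_eq (hG : IsMetricOn G S) (hy : y ∈ S) (b : Module.Basis κ ℝ E)
    (hcard : Fintype.card ι = Module.finrank ℝ E)
    (horth : ∀ i j, G y (ε i) (ε j) = if i = j then 1 else 0) (Q : E →ₗ[ℝ] E →ₗ[ℝ] ℝ) :
    ∑ i, Q (ε i) (ε i) = ∑ a, Q (b a)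
      ((G y).inverse (LinearMap.toContinuousLinearMap (b.coord a))) := by
  have hinv : ∀ a, (G y).inverse (LinearMap.toContinuousLinearMap (b.coord a))
      = ∑ i, b.coord a (ε i) • ε i := fun a =>
    hG.inverse_eq_sum_orthonormal hy hcard horth _
  simp only [hinv, map_sum, map_smul, smul_eq_mul]
  rw [Finset.sum_comm]
  refine Finset.sum_congr rfl fun i _ => ?_
  have h2 : ∑ a, b.coord a (ε i) • b a = ε i := b.sum_repr (ε i)
  calc Q (ε i) (ε i) = Q (∑ a, b.coord a (ε i) • b a) (ε i) := by rw [h2]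
    _ = _ := by
      rw [map_sum, LinearMap.sum_apply]
      simp only [map_smul, LinearMap.smul_apply, smul_eq_mul]

/-- The scalar curvature in coordinates. -/
def coordScalar (b : Module.Basis κ ℝ E) (G : E → E →L[ℝ] E →L[ℝ] ℝ) (y : E) : ℝ :=
  ∑ a, ∑ c, G y (coordCurvature G y (b a) (b c)
    ((G y).inverse (LinearMap.toContinuousLinearMap (b.coord c))))
    ((G y).inverse (LinearMap.toContinuousLinearMap (b.coord a)))

/-- Two applications of the trace identity, one for each contracted pair of slots, eliminate the
orthonormal frame. -/
theorem sum_curvature_orthonormal (hG : IsMetricOn G S) (hy : y ∈ S) (b : Module.Basis κ ℝ E)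
    (hcard : Fintype.card ι = Module.finrank ℝ E)
    (horth : ∀ i j, G y (ε i) (ε j) = if i = j then 1 else 0) :
    ∑ i, ∑ j, G y (coordCurvature G y (ε i) (ε j) (ε j)) (ε i) = coordScalar b G y := by
  have hC := (hG.contDiffAt_christoffelMap hy).differentiableAt (by simp)
  have h1 : ∀ i, ∑ j, G y (coordCurvature G y (ε i) (ε j) (ε j)) (ε i)
      = ∑ c, G y (coordCurvature G y (ε i) (b c)
        ((G y).inverse (LinearMap.toContinuousLinearMap (b.coord c)))) (ε i) := by
    intro i
    refine hG.sum_orthonormal_eq hy b hcard horth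
      (LinearMap.mk₂ ℝ (fun u v => G y (coordCurvature G y (ε i) u v) (ε i)) ?_ ?_ ?_ ?_)
    · intro u u' v
      simp only [coordCurvature_eq hC, map_add, map_sub, add_apply, sub_apply]
      ring
    · intro r u v
      simp only [coordCurvature_eq hC, map_add, map_sub, add_apply, sub_apply, map_smul,
        smul_apply, smul_eq_mul]
      ring
    · intro u v v'
      simp only [coordCurvature_eq hC, map_add, map_sub, add_apply, sub_apply]
      ring
    · intro r u v
      simp only [coordCurvature_eq hC, map_add, map_sub, add_apply, sub_apply, map_smul,
        smul_apply, smul_eq_mul]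
      ring
  simp only [h1, coordScalar]
  rw [Finset.sum_comm]
  conv_rhs => rw [Finset.sum_comm]
  refine Finset.sum_congr rfl fun c _ => ?_
  refine hG.sum_orthonormal_eq hy b hcard horth
      (LinearMap.mk₂ ℝ (fun u v => G y (coordCurvature G y u (b c)
        ((G y).inverse (LinearMap.toContinuousLinearMap (b.coord c)))) v) ?_ ?_ ?_ ?_)
  · intro u u' v
    simp only [coordCurvature_eq hC, map_add, map_sub, add_apply, sub_apply]
    ring
  · intro r u v
    simp only [coordCurvature_eq hC, map_add, map_sub, add_apply, sub_apply, map_smul,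
      smul_apply, smul_eq_mul]
    ring
  · intro u v v'
    simp only [map_add]
  · intro r u v
    simp only [map_smul, smul_eq_mul]

theorem continuousAt_coordScalar (hG : IsMetricOn G S) (hy : y ∈ S) (b : Module.Basis κ ℝ E) :
    ContinuousAt (coordScalar b G) y := by
  have hc := hG.contDiffAt_christoffelMap hy
  have h1 : ContinuousAt (christoffelMap G) y := hc.continuousAt
  have h2 : ContinuousAt (fderiv ℝ (christoffelMap G)) y :=
    (hc.fderiv_right (m := ∞) le_rfl).continuousAt
  have h3 : ContinuousAt G y := (hG.contDiffAt hy).continuousAt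
  have h4 : ContinuousAt (fun y => (G y).inverse) y := (hG.contDiffAt_inverse hy).continuousAt
  have h5 : coordScalar b G =ᶠ[𝓝 y] fun y => ∑ a, ∑ c, G y
      (fderiv ℝ (christoffelMap G) y (b a) (b c)
        ((G y).inverse (LinearMap.toContinuousLinearMap (b.coord c)))
      - fderiv ℝ (christoffelMap G) y (b c) (b a)
        ((G y).inverse (LinearMap.toContinuousLinearMap (b.coord c)))
      + christoffelMap G y (b a) (christoffelMap G y (b c)
        ((G y).inverse (LinearMap.toContinuousLinearMap (b.coord c))))
      - christoffelMap G y (b c) (christoffelMap G y (b a)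
        ((G y).inverse (LinearMap.toContinuousLinearMap (b.coord c)))))
    ((G y).inverse (LinearMap.toContinuousLinearMap (b.coord a))) := by
    filter_upwards [hG.isOpen.mem_nhds hy] with z hz
    have hC := (hG.contDiffAt_christoffelMap hz).differentiableAt (by simp)
    simp only [coordScalar, coordCurvature_eq hC]
  refine ContinuousAt.congr ?_ h5.symm
  fun_prop

end Trace

section Comparison

variable {y₀ : E}

theorem exists_coercive (hG : IsMetricOn G S) (hy : y₀ ∈ S) :
    ∃ m > 0, ∀ v, m * ‖v‖ ^ 2 ≤ G y₀ v v := by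
  obtain h | h := subsingleton_or_nontrivial E
  · exact ⟨1, one_pos, fun v => by simp [Subsingleton.elim v 0]⟩
  · obtain ⟨v₀, hv₀, hmin⟩ := (isCompact_sphere (0 : E) 1).exists_isMinOn
      (NormedSpace.sphere_nonempty.2 zero_le_one) (f := fun v => G y₀ v v) (by fun_prop)
    have hv₀' : v₀ ≠ 0 := by
      rintro rfl
      simp at hv₀
    refine ⟨G y₀ v₀ v₀, hG.pos _ hy _ hv₀', fun v => ?_⟩
    by_cases hv : v = 0
    · simp [hv]
    have hn : ‖v‖ ≠ 0 := norm_ne_zero_iff.2 hv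
    have h1 : ‖v‖⁻¹ • v ∈ Metric.sphere (0 : E) 1 := by
      simp [norm_smul, hn]
    have h2 : G y₀ v₀ v₀ ≤ G y₀ (‖v‖⁻¹ • v) (‖v‖⁻¹ • v) := hmin h1
    simp only [map_smul, smul_apply, smul_eq_mul] at h2
    calc G y₀ v₀ v₀ * ‖v‖ ^ 2 ≤ (‖v‖⁻¹ * (‖v‖⁻¹ * G y₀ v v)) * ‖v‖ ^ 2 := by gcongr
      _ = G y₀ v v := by field_simp

theorem eventually_comparison (hG : IsMetricOn G S) (hy : y₀ ∈ S) :
    ∀ᶠ y in 𝓝 y₀, ∀ v, G y v v ≤ 4 * G y₀ v v ∧ G y₀ v v ≤ 4 * G y v v := by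
  obtain ⟨m, hm, hmG⟩ := hG.exists_coercive hy
  -- A relative error of `3/4` places `G y v v` between `1/4` and `7/4` of `G y₀ v v`, hence both
  -- factors `4`.
  have h1 : ∀ᶠ y in 𝓝 y₀, ‖G y - G y₀‖ < 3 / 4 * m := by
    have h2 : ContinuousAt (fun y => ‖G y - G y₀‖) y₀ :=
      ((hG.contDiffAt hy).continuousAt.sub continuousAt_const).norm
    exact h2.eventually_lt continuousAt_const (by simpa using by positivity)
  filter_upwards [h1] with y h v
  have h3 : |G y v v - G y₀ v v| ≤ 3 / 4 * G y₀ v v := by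
    calc |G y v v - G y₀ v v| = ‖(G y - G y₀) v v‖ := by simp
      _ ≤ ‖G y - G y₀‖ * ‖v‖ * ‖v‖ := (G y - G y₀).le_opNorm₂ v v
      _ ≤ 3 / 4 * m * ‖v‖ * ‖v‖ := by gcongr
      _ = 3 / 4 * (m * ‖v‖ ^ 2) := by ring
      _ ≤ _ := by linarith [hmG v]
  have h4 : 0 ≤ G y₀ v v := le_trans (by positivity) (hmG v)
  rw [abs_le] at h3
  constructor <;> linarith

end Comparison

end IsMetricOn

end CoordinateMetric

/-! ### The metric, curvature and gradient in the charts of the manifold -/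

section ChartMetric

variable {n : ℕ} {X : Type*} [MetricSpace X] [ChartedSpace (EuclideanSpace ℝ (Fin (n + 1))) X]

local notation "𝔼" => EuclideanSpace ℝ (Fin (n + 1))
local notation "𝕀" => 𝓡 (n + 1)

section NoMetric

variable [IsManifold (𝓡 (n + 1)) ∞ X]

theorem mdifferentiableAt_chart_symm (q : X) {y : 𝔼} (hy : y ∈ (extChartAt 𝕀 q).target) :
    MDifferentiableAt 𝓘(ℝ, 𝔼) 𝕀 (extChartAt 𝕀 q).symm y :=
  ((contMDiffOn_extChartAt_symm (n := ∞) q).contMDiffAt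
    ((isOpen_extChartAt_target q).mem_nhds hy)).mdifferentiableAt (by simp)

theorem mdifferentiableAt_chart (q : X) {p : X} (hp : p ∈ (extChartAt 𝕀 q).source) :
    MDifferentiableAt 𝕀 𝓘(ℝ, 𝔼) (extChartAt 𝕀 q) p :=
  mdifferentiableAt_extChartAt (by simpa using hp)

/-- The derivative of the preferred chart at `q`. -/
def chartD (n : ℕ) {X : Type*} [MetricSpace X] [ChartedSpace (EuclideanSpace ℝ (Fin (n + 1))) X]
    (q p : X) : TangentSpace (𝓡 (n + 1)) p →L[ℝ] EuclideanSpace ℝ (Fin (n + 1)) :=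
  mfderiv (𝓡 (n + 1)) 𝓘(ℝ, EuclideanSpace ℝ (Fin (n + 1))) (extChartAt (𝓡 (n + 1)) q) p

/-- The derivative of the inverse of the preferred chart at `q`. -/
def symmD (q : X) (y : 𝔼) : 𝔼 →L[ℝ] TangentSpace 𝕀 ((extChartAt 𝕀 q).symm y) :=
  mfderiv 𝓘(ℝ, 𝔼) 𝕀 (extChartAt 𝕀 q).symm y

theorem symmD_chartD (q : X) {p : X} (hp : p ∈ (extChartAt 𝕀 q).source) (v : TangentSpace 𝕀 p) :
    (symmD q (extChartAt 𝕀 q p) (chartD n q p v) : 𝔼) = v := by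
  have h := mfderivWithin_extChartAt_symm_comp_mfderiv_extChartAt' (I := 𝕀) hp
  rw [ModelWithCorners.range_eq_univ, mfderivWithin_univ] at h
  exact congrArg (fun L => L v) h

theorem chartD_symmD (q : X) {y : 𝔼} (hy : y ∈ (extChartAt 𝕀 q).target) (v : 𝔼) :
    chartD n q ((extChartAt 𝕀 q).symm y) (symmD q y v) = v := by
  have h := mfderiv_extChartAt_comp_mfderivWithin_extChartAt_symm (I := 𝕀) hy
  rw [ModelWithCorners.range_eq_univ, mfderivWithin_univ] at h
  exact congrArg (fun L => L v) h

theorem symmD_chartD' (q : X) {y : 𝔼} (hy : y ∈ (extChartAt 𝕀 q).target)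
    (v : TangentSpace 𝕀 ((extChartAt 𝕀 q).symm y)) :
    symmD q y (chartD n q ((extChartAt 𝕀 q).symm y) v) = v := by
  have h := mfderivWithin_extChartAt_symm_comp_mfderiv_extChartAt (I := 𝕀) hy
  rw [ModelWithCorners.range_eq_univ, mfderivWithin_univ] at h
  exact congrArg (fun L => L v) h

variable (n) in
/-- The change of coordinates between two preferred charts. -/
def transition (p q : X) : 𝔼 → 𝔼 := extChartAt 𝕀 q ∘ (extChartAt 𝕀 p).symm

variable (n) in
/-- The domain of the change of coordinates. -/
def transitionSource (p q : X) : Set 𝔼 :=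
  (extChartAt 𝕀 p).target ∩ (extChartAt 𝕀 p).symm ⁻¹' (extChartAt 𝕀 q).source

theorem isOpen_transitionSource (p q : X) : IsOpen (transitionSource n p q) :=
  (continuousOn_extChartAt_symm p).isOpen_inter_preimage (isOpen_extChartAt_target p)
    (isOpen_extChartAt_source q)

theorem mem_transitionSource {p q : X} (hp : p ∈ (extChartAt 𝕀 q).source) :
    extChartAt 𝕀 p p ∈ transitionSource n p q :=
  ⟨mem_extChartAt_target p, by simpa [extChartAt_to_inv] using hp⟩

theorem contDiffOn_transition (p q : X) :
    ContDiffOn ℝ ∞ (transition n p q) (transitionSource n p q) := by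
  rw [← contMDiffOn_iff_contDiffOn]
  refine (contMDiffOn_extChartAt (I := 𝕀) (n := ∞) (x := q)).comp
    ((contMDiffOn_extChartAt_symm p).mono inter_subset_left) ?_
  intro y hy
  simpa [transitionSource] using hy.2

theorem fderiv_transition (p q : X) {y : 𝔼} (hy : y ∈ transitionSource n p q) (v : 𝔼) :
    fderiv ℝ (transition n p q) y v = chartD n q ((extChartAt 𝕀 p).symm y) (symmD p y v) := by
  have h := mfderiv_comp y (mdifferentiableAt_chart q hy.2) (mdifferentiableAt_chart_symm p hy.1)
  rw [← mfderiv_eq_fderiv]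
  exact congrArg (fun L => L v) h

theorem fderiv_transition_chartD {q p : X} (hp : p ∈ (extChartAt 𝕀 q).source)
    (v : TangentSpace 𝕀 p) :
    fderiv ℝ (transition n p q) (extChartAt 𝕀 p p) (chartD n p p v) = chartD n q p v := by
  rw [fderiv_transition p q (mem_transitionSource hp)]
  have h2 := symmD_chartD p (mem_extChartAt_source p) v
  have h3 : (extChartAt 𝕀 p).symm (extChartAt 𝕀 p p) = p := extChartAt_to_inv p
  -- The tangent spaces at `p` and at its image under chart and inverse chart are different types;
  -- generalising the base point allows the equality of points to be substituted.
  have h4 : ∀ (p' : X), p' = p → ∀ w : TangentSpace 𝕀 p', (w : 𝔼) = v →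
      chartD n q p' w = chartD n q p v := by
    rintro p' rfl w rfl
    rfl
  exact h4 _ h3 _ h2

theorem mfderiv_eq_fderiv_chart (q : X) {p : X} (hp : p ∈ (extChartAt 𝕀 q).source) {f : X → ℝ}
    (hf : MDifferentiableAt 𝕀 𝓘(ℝ, ℝ) f p) (v : TangentSpace 𝕀 p) :
    (mfderiv 𝕀 𝓘(ℝ, ℝ) f p v : ℝ) = fderiv ℝ (f ∘ (extChartAt 𝕀 q).symm) (extChartAt 𝕀 q p)
      (chartD n q p v) := by
  have h3 : (extChartAt 𝕀 q).symm (extChartAt 𝕀 q p) = p := (extChartAt 𝕀 q).left_inv hp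
  have hd := mdifferentiableAt_chart_symm q ((extChartAt 𝕀 q).map_source hp)
  have h := mfderiv_comp (extChartAt 𝕀 q p) (I'' := 𝓘(ℝ, ℝ)) (g := f) (by rwa [h3]) hd
  rw [← mfderiv_eq_fderiv, h]
  have h2 := symmD_chartD q hp v
  have h4 : ∀ (p' : X), p' = p → ∀ w : 𝔼, w = v →
      (mfderiv 𝕀 𝓘(ℝ, ℝ) f p v : ℝ) = mfderiv 𝕀 𝓘(ℝ, ℝ) f p' w := by
    rintro p' rfl w rfl
    rfl
  exact h4 _ h3 _ h2

end NoMetric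

variable [RiemannianBundle (fun x : X => TangentSpace (𝓡 (n + 1)) x)]

theorem chartMetric_apply (q : X) (y u v : 𝔼) :
    chartMetric q y u v = inner ℝ (symmD q y u) (symmD q y v) := rfl

variable [IsManifold (𝓡 (n + 1)) ∞ X]

theorem chartMetric_chartD' (q : X) {y : 𝔼} (hy : y ∈ (extChartAt 𝕀 q).target)
    (u v : TangentSpace 𝕀 ((extChartAt 𝕀 q).symm y)) :
    chartMetric q y (chartD n q _ u) (chartD n q _ v) = inner ℝ u v := by
  rw [chartMetric_apply, symmD_chartD' q hy, symmD_chartD' q hy]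

theorem chartMetric_chartD (q : X) {p : X} (hp : p ∈ (extChartAt 𝕀 q).source)
    (u v : TangentSpace 𝕀 p) :
    chartMetric q (extChartAt 𝕀 q p) (chartD n q p u) (chartD n q p v) = inner ℝ u v := by
  obtain ⟨y, hy, rfl⟩ : ∃ y ∈ (extChartAt 𝕀 q).target, (extChartAt 𝕀 q).symm y = p :=
    ⟨_, (extChartAt 𝕀 q).map_source hp, (extChartAt 𝕀 q).left_inv hp⟩
  rw [(extChartAt 𝕀 q).right_inv hy]
  exact chartMetric_chartD' q hy u v

theorem chartMetric_transition (p q : X) {y : 𝔼} (hy : y ∈ transitionSource n p q) (u v : 𝔼) :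
    chartMetric p y u v = chartMetric q (transition n p q y)
      (fderiv ℝ (transition n p q) y u) (fderiv ℝ (transition n p q) y v) := by
  rw [fderiv_transition p q hy, fderiv_transition p q hy, chartMetric_apply]
  exact (chartMetric_chartD q hy.2 _ _).symm

theorem surjective_fderiv_transition (p q : X) {y : 𝔼} (hy : y ∈ transitionSource n p q) :
    Function.Surjective (fderiv ℝ (transition n p q) y) := by
  intro v
  obtain ⟨z, hz, hzy⟩ : ∃ z ∈ (extChartAt 𝕀 q).target,
      (extChartAt 𝕀 q).symm z = (extChartAt 𝕀 p).symm y :=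
    ⟨_, (extChartAt 𝕀 q).map_source hy.2, (extChartAt 𝕀 q).left_inv hy.2⟩
  obtain ⟨w, hw⟩ : ∃ w : TangentSpace 𝕀 ((extChartAt 𝕀 p).symm y),
      chartD n q ((extChartAt 𝕀 p).symm y) w = v := by
    rw [← hzy]
    exact ⟨_, chartD_symmD q hz v⟩
  refine ⟨chartD n p ((extChartAt 𝕀 p).symm y) w, ?_⟩
  rw [fderiv_transition p q hy, symmD_chartD' p hy.1, hw]

theorem chart_frame_orthonormal (q : X) {p : X} (hp : p ∈ (extChartAt 𝕀 q).source)
    (i j : Fin (n + 1)) :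
    chartMetric q (extChartAt 𝕀 q p)
      (chartD n q p (tangentFrame n p i))
      (chartD n q p (tangentFrame n p j)) = if i = j then 1 else 0 := by
  rw [chartMetric_chartD q hp]
  exact orthonormal_iff_ite.1 (tangentFrame n p).orthonormal i j

/-- Each of the `(n + 1) ^ 2` summands of the scalar curvature is one component of the Riemann
tensor, so it is bounded by the Euclidean norm of all components. -/
theorem abs_scalarCurvature_le (p : X) :
    |scalarCurvature n p| ≤ ((n : ℝ) + 1) ^ 2 * riemannNorm n p := by
  have h : ∀ i j, |riemannTensor p (tangentFrame n p i) (tangentFrame n p j)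
    (tangentFrame n p j) (tangentFrame n p i)| ≤ riemannNorm n p := by
    intro i j
    refine Real.abs_le_sqrt ?_
    have h1 : ∀ i j k, 0 ≤ ∑ l, (riemannTensor p (tangentFrame n p i) (tangentFrame n p j)
      (tangentFrame n p k) (tangentFrame n p l)) ^ 2 := fun i j k =>
      Finset.sum_nonneg fun _ _ => sq_nonneg _
    have h2 : ∀ i j, 0 ≤ ∑ k, ∑ l, (riemannTensor p (tangentFrame n p i) (tangentFrame n p j)
      (tangentFrame n p k) (tangentFrame n p l)) ^ 2 := fun i j =>
      Finset.sum_nonneg fun _ _ => h1 _ _ _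
    refine le_trans ?_ (Finset.single_le_sum (fun i _ => Finset.sum_nonneg fun j _ => h2 i j)
      (Finset.mem_univ i))
    refine le_trans ?_ (Finset.single_le_sum (fun j _ => h2 i j) (Finset.mem_univ j))
    refine le_trans ?_ (Finset.single_le_sum (fun k _ => h1 i j k) (Finset.mem_univ j))
    exact Finset.single_le_sum (f := fun l => (riemannTensor p (tangentFrame n p i)
      (tangentFrame n p j) (tangentFrame n p j) (tangentFrame n p l)) ^ 2)
      (fun l _ => sq_nonneg _) (Finset.mem_univ i)
  calc |scalarCurvature n p| ≤ ∑ i, ∑ j, |riemannTensor p (tangentFrame n p i)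
        (tangentFrame n p j) (tangentFrame n p j) (tangentFrame n p i)| :=
        (Finset.abs_sum_le_sum_abs _ _).trans
          (Finset.sum_le_sum fun i _ => Finset.abs_sum_le_sum_abs _ _)
    _ ≤ ∑ _i : Fin (n + 1), ∑ _j : Fin (n + 1), riemannNorm n p :=
        Finset.sum_le_sum fun i _ => Finset.sum_le_sum fun j _ => h i j
    _ = _ := by
        simp
        ring

variable [IsContMDiffRiemannianBundle (𝓡 (n + 1)) ∞ (EuclideanSpace ℝ (Fin (n + 1)))
      (fun x : X => TangentSpace (𝓡 (n + 1)) x)]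

theorem contDiffOn_chartMetric (q : X) :
    ContDiffOn ℝ ∞ (chartMetric q) (extChartAt 𝕀 q).target := by
  have hopen := isOpen_extChartAt_target (I := 𝕀) q
  rw [contDiffOn_clm_apply]
  intro u
  rw [contDiffOn_clm_apply]
  intro v
  rw [← contMDiffOn_iff_contDiffOn]
  -- Coordinate vector fields are smooth because they come from the tangent map of the inverse
  -- chart; smoothness of the bundle metric then gives smoothness of its components.
  have hsec : ∀ w : 𝔼, ContMDiffOn 𝓘(ℝ, 𝔼) (𝕀).tangent ∞
      (fun y => (⟨(extChartAt 𝕀 q).symm y, symmD q y w⟩ : TangentBundle 𝕀 X))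
      (extChartAt 𝕀 q).target := by
    intro w
    have h1 := (contMDiffOn_extChartAt_symm (I := 𝕀) (n := ∞) q).contMDiffOn_tangentMapWithin
      (m := ∞) le_rfl hopen.uniqueMDiffOn
    have h2 : ContMDiff 𝓘(ℝ, 𝔼) (𝓘(ℝ, 𝔼)).tangent ∞
        (fun y : 𝔼 => (⟨y, (w : TangentSpace 𝓘(ℝ, 𝔼) y)⟩ : TangentBundle 𝓘(ℝ, 𝔼) 𝔼)) :=
      contMDiff_vectorSpace_iff_contDiff.2 contDiff_const
    have h3 := h1.comp (h2.contMDiffOn (s := (extChartAt 𝕀 q).target)) (fun y hy => hy)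
    refine h3.congr fun y hy => ?_
    simp only [Function.comp, tangentMapWithin, mfderivWithin_of_isOpen hopen hy]
    rfl
  exact ContMDiffOn.inner_bundle (hsec u) (hsec v)

theorem isMetricOn_chartMetric (q : X) :
    IsMetricOn (chartMetric q) (extChartAt 𝕀 q).target where
  isOpen := isOpen_extChartAt_target q
  contDiffOn := contDiffOn_chartMetric q
  symm y _ u v := by
    rw [chartMetric_apply, chartMetric_apply, real_inner_comm]
  pos y hy v hv := by
    rw [chartMetric_apply]
    refine real_inner_self_pos.2 fun h0 => hv ?_
    rw [← chartD_symmD q hy v, h0, map_zero]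

/-- The Riemann tensor may be computed in any preferred chart. -/
theorem riemannTensor_eq (q : X) {p : X} (hp : p ∈ (extChartAt 𝕀 q).source)
    (u v w z : TangentSpace 𝕀 p) :
    riemannTensor p u v w z = chartMetric q (extChartAt 𝕀 q p)
      (coordCurvature (chartMetric q) (extChartAt 𝕀 q p)
        (chartD n q p u) (chartD n q p v) (chartD n q p w)) (chartD n q p z) := by
  have hy : extChartAt 𝕀 p p ∈ transitionSource n p q := mem_transitionSource hp
  have hφ : transition n p q (extChartAt 𝕀 p p) = extChartAt 𝕀 q p := by
    simp [transition]
  have hmetric' : IsMetricOn (chartMetric p) (transitionSource n p q) :=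
    ⟨isOpen_transitionSource p q, (contDiffOn_chartMetric p).mono inter_subset_left,
      fun y hy => (isMetricOn_chartMetric p).symm y hy.1,
      fun y hy => (isMetricOn_chartMetric p).pos y hy.1⟩
  have h0 : riemannTensor p u v w z = chartMetric p (extChartAt 𝕀 p p)
      (coordCurvature (chartMetric p) (extChartAt 𝕀 p p)
        (chartD n p p u) (chartD n p p v) (chartD n p p w)) (chartD n p p z) := rfl
  rw [h0, chartMetric_transition p q hy, (isMetricOn_chartMetric q).fderiv_coordCurvature hmetric'
    (contDiffOn_transition p q) (fun y hy => (extChartAt 𝕀 q).map_source hy.2)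
    (fun y hy => surjective_fderiv_transition p q hy)
    (fun y hy => chartMetric_transition p q hy) hy, hφ]
  simp only [fderiv_transition_chartD hp]

theorem scalarCurvature_eq (q : X) {p : X} (hp : p ∈ (extChartAt 𝕀 q).source) :
    scalarCurvature n p = IsMetricOn.coordScalar
      (EuclideanSpace.basisFun (Fin (n + 1)) ℝ).toBasis (chartMetric q) (extChartAt 𝕀 q p) := by
  rw [← (isMetricOn_chartMetric q).sum_curvature_orthonormal ((extChartAt 𝕀 q).map_source hp) _
    (by simp) (chart_frame_orthonormal q hp)]
  simp only [scalarCurvature, riemannTensor_eq q hp]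

/-- By chart independence, all points near `q` can use the single chart at `q`, where the frame-free
formula is continuous. -/
theorem continuous_scalarCurvature : Continuous (scalarCurvature n (X := X)) := by
  rw [continuous_iff_continuousAt]
  intro q
  have h1 := (isMetricOn_chartMetric q).continuousAt_coordScalar (mem_extChartAt_target q)
    (EuclideanSpace.basisFun (Fin (n + 1)) ℝ).toBasis
  refine (h1.comp (continuousAt_extChartAt q)).congr ?_
  filter_upwards [extChartAt_source_mem_nhds (I := 𝕀) q] with p hp
  exact (scalarCurvature_eq q hp).symm

theorem continuous_gradNorm {f : X → ℝ} (hf : ContMDiff 𝕀 𝓘(ℝ, ℝ) ∞ f) :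
    Continuous (gradNorm n f) := by
  rw [continuous_iff_continuousAt]
  intro q
  have hmem := mem_extChartAt_target (I := 𝕀) q
  have hcd : ContDiffAt ℝ ∞ (f ∘ (extChartAt 𝕀 q).symm) (extChartAt 𝕀 q q) := by
    rw [← contMDiffAt_iff_contDiffAt]
    exact (hf.contMDiffAt).comp _ ((contMDiffOn_extChartAt_symm q).contMDiffAt
      ((isOpen_extChartAt_target q).mem_nhds hmem))
  have h1 : ContinuousAt (fderiv ℝ (f ∘ (extChartAt 𝕀 q).symm)) (extChartAt 𝕀 q q) :=
    (hcd.fderiv_right (m := ∞) le_rfl).continuousAt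
  have h2 := ((isMetricOn_chartMetric q).contDiffAt_inverse hmem).continuousAt
  have h3 : ContinuousAt (fun y => √(fderiv ℝ (f ∘ (extChartAt 𝕀 q).symm) y
      ((chartMetric q y).inverse (fderiv ℝ (f ∘ (extChartAt 𝕀 q).symm) y))))
      (extChartAt 𝕀 q q) := (h1.clm_apply (h2.clm_apply h1)).sqrt
  refine (h3.comp (continuousAt_extChartAt q)).congr ?_
  filter_upwards [extChartAt_source_mem_nhds (I := 𝕀) q] with p hp
  simp only [gradNorm, Function.comp]
  congr 1
  rw [← (isMetricOn_chartMetric q).sum_sq_orthonormal ((extChartAt 𝕀 q).map_source hp)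
    (by simp) (chart_frame_orthonormal q hp)]
  refine Finset.sum_congr rfl fun i _ => ?_
  exact congrArg (· ^ 2) (mfderiv_eq_fderiv_chart q hp
    (hf.mdifferentiableAt (by simp)) (tangentFrame n p i)).symm

end ChartMetric

/-! ### Gradient norms as norms of covectors -/

section Gradient

variable {n : ℕ} {X : Type*} [MetricSpace X] [ChartedSpace (EuclideanSpace ℝ (Fin (n + 1))) X]
  [IsManifold (𝓡 (n + 1)) ∞ X] [RiemannianBundle (fun x : X => TangentSpace (𝓡 (n + 1)) x)]

local notation "𝔼" => EuclideanSpace ℝ (Fin (n + 1))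
local notation "𝕀" => 𝓡 (n + 1)

/-- The coordinates of a covector in the orthonormal frame. -/
def covector (p : X) : (TangentSpace 𝕀 p →L[ℝ] ℝ) →ₗ[ℝ] 𝔼 where
  toFun L := WithLp.toLp 2 fun i => L (tangentFrame n p i)
  map_add' L L' := by ext i; simp
  map_smul' c L := by ext i; simp

theorem gradNorm_eq_of_hasMFDerivAt {f : X → ℝ} {p : X} {L : TangentSpace 𝕀 p →L[ℝ] ℝ}
    (h : HasMFDerivAt 𝕀 𝓘(ℝ, ℝ) f p L) : gradNorm n f p = ‖covector p L‖ := by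
  rw [EuclideanSpace.norm_eq]
  simp only [gradNorm, h.mfderiv, covector, Real.norm_eq_abs, sq_abs]
  rfl

theorem gradNorm_nonneg (f : X → ℝ) (p : X) : 0 ≤ gradNorm n f p := Real.sqrt_nonneg _

theorem norm_covector_le {p : X} {L : TangentSpace 𝕀 p →L[ℝ] ℝ} {K : ℝ} (hK : 0 ≤ K)
    (h : ∀ v : TangentSpace 𝕀 p, |L v| ≤ K * √(inner ℝ v v)) : ‖covector p L‖ ≤ K := by
  -- The Riesz representative of `L`: both `L v` and `⟪v, v⟫` equal the squared covector norm.
  set v : TangentSpace 𝕀 p := ∑ i, L (tangentFrame n p i) • tangentFrame n p i with hv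
  have hn : ‖covector p L‖ ^ 2 = ∑ i, L (tangentFrame n p i) ^ 2 := by
    rw [EuclideanSpace.norm_sq_eq]
    simp [covector]
  have h1 : L v = ‖covector p L‖ ^ 2 := by
    rw [hn, hv]
    simp [pow_two]
  have h2 : inner ℝ v v = ‖covector p L‖ ^ 2 := by
    rw [hn, hv, (tangentFrame n p).orthonormal.inner_sum]
    simp [pow_two]
  have h3 := h v
  rw [h2, h1, Real.sqrt_sq (norm_nonneg _), abs_of_nonneg (by positivity), pow_two] at h3
  by_cases h0 : ‖covector p L‖ = 0
  · rw [h0]; exact hK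
  · exact le_of_mul_le_mul_right h3 (lt_of_le_of_ne (norm_nonneg _) (Ne.symm h0))

theorem HasMFDerivAt.comp_real {f : X → ℝ} {p : X} {L : TangentSpace 𝕀 p →L[ℝ] ℝ}
    (h : HasMFDerivAt 𝕀 𝓘(ℝ, ℝ) f p L) {φ : ℝ → ℝ} {φ' : ℝ} (hφ : HasDerivAt φ φ' (f p)) :
    HasMFDerivAt 𝕀 𝓘(ℝ, ℝ) (fun x => φ (f x)) p (φ' • L) := by
  have h1 := (hφ.hasFDerivAt.hasMFDerivAt).comp p h
  have h2 : (ContinuousLinearMap.toSpanSingleton ℝ φ').comp L = φ' • L := by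
    ext v
    simp [mul_comm]
  rw [← h2]
  exact h1

theorem hasMFDerivAt_real {f : X → ℝ} (hf : ContMDiff 𝕀 𝓘(ℝ, ℝ) ∞ f) (p : X) :
    ∃ L : TangentSpace 𝕀 p →L[ℝ] ℝ, HasMFDerivAt 𝕀 𝓘(ℝ, ℝ) f p L :=
  ⟨_, (hf.mdifferentiableAt (by simp)).hasMFDerivAt⟩

end Gradient

/-! ### Comparison of the Riemannian distance with chart distances -/

section LocalDistance

variable {n : ℕ} {X : Type*} [MetricSpace X] [ChartedSpace (EuclideanSpace ℝ (Fin (n + 1))) X]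
  [IsManifold (𝓡 (n + 1)) ∞ X] [RiemannianBundle (fun x : X => TangentSpace (𝓡 (n + 1)) x)]
  [IsContMDiffRiemannianBundle (𝓡 (n + 1)) ∞ (EuclideanSpace ℝ (Fin (n + 1)))
      (fun x : X => TangentSpace (𝓡 (n + 1)) x)]
  [IsRiemannianManifold (𝓡 (n + 1)) X]

local notation "𝔼" => EuclideanSpace ℝ (Fin (n + 1))
local notation "𝕀" => 𝓡 (n + 1)

/-- The distance is bounded by the length of the segment in a chart. -/
theorem dist_symm_le (q : X) {a b : 𝔼} {K : ℝ} (hK : 0 ≤ K)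
    (hseg : segment ℝ a b ⊆ (extChartAt 𝕀 q).target)
    (hbd : ∀ y ∈ segment ℝ a b, chartMetric q y (b - a) (b - a) ≤ K ^ 2) :
    dist ((extChartAt 𝕀 q).symm a) ((extChartAt 𝕀 q).symm b) ≤ K := by
  let η : ℝ → 𝔼 := ContinuousAffineMap.lineMap (R := ℝ) a b
  have hηmem : ∀ t ∈ Icc (0 : ℝ) 1, η t ∈ segment ℝ a b := by
    intro t ht
    rw [segment_eq_image_lineMap]
    exact ⟨t, ht, rfl⟩
  have hηd : ∀ t, HasDerivAt η (b - a) t := by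
    intro t
    have : η = fun t : ℝ => a + t • (b - a) := by
      ext1 t
      simp [η, ContinuousAffineMap.coe_lineMap_eq, AffineMap.lineMap_apply, add_comm]
    rw [this]
    simpa using ((hasDerivAt_id t).smul_const (b - a)).const_add a
  have hηs : ContDiff ℝ 1 η := ContinuousAffineMap.contDiff _
  have hdist : ENNReal.ofReal (dist ((extChartAt 𝕀 q).symm a) ((extChartAt 𝕀 q).symm b))
      ≤ ENNReal.ofReal K := by
    rw [← edist_dist, IsRiemannianManifold.out (I := 𝕀)]
    set γ : ℝ → X := (extChartAt 𝕀 q).symm ∘ η with hγ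
    have h1 : Manifold.riemannianEDist 𝕀 ((extChartAt 𝕀 q).symm a) ((extChartAt 𝕀 q).symm b)
        ≤ Manifold.pathELength 𝕀 γ 0 1 := by
      apply Manifold.riemannianEDist_le_pathELength _ _ _ zero_le_one
      · exact (contMDiffOn_extChartAt_symm q).comp hηs.contMDiff.contMDiffOn
          (fun t ht => hseg (hηmem t ht))
      · simp [γ, η, ContinuousAffineMap.coe_lineMap_eq]
      · simp [γ, η, ContinuousAffineMap.coe_lineMap_eq]
    refine h1.trans ?_
    rw [Manifold.pathELength_eq_lintegral_mfderiv_Icc]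
    calc ∫⁻ t in Icc (0 : ℝ) 1, ‖mfderiv 𝓘(ℝ, ℝ) 𝕀 γ t 1‖ₑ
        ≤ ∫⁻ t in Icc (0 : ℝ) 1, ENNReal.ofReal K := by
          apply setLIntegral_mono' measurableSet_Icc (fun t ht ↦ ?_)
          have hm := mdifferentiableAt_chart_symm q (hseg (hηmem t ht))
          have h2 : mfderiv 𝓘(ℝ, ℝ) 𝕀 γ t 1 = symmD q (η t) (b - a) := by
            have h3 := mfderiv_comp t hm (hηd t).differentiableAt.mdifferentiableAt
            have h4 := congrArg (fun L => L (1 : ℝ)) h3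
            refine h4.trans ?_
            rw [mfderiv_eq_fderiv]
            have h5 : fderiv ℝ η t 1 = b - a := by
              rw [(hηd t).hasFDerivAt.fderiv]
              simp
            exact congrArg (symmD q (η t)) h5
          have h6 : ‖(symmD q (η t) (b - a) : TangentSpace 𝕀 ((extChartAt 𝕀 q).symm (η t)))‖
              ≤ K := by
            refine abs_le_of_sq_le_sq' ?_ hK |>.2
            rw [← real_inner_self_eq_norm_sq]
            exact hbd _ (hηmem t ht)
          have h7 : ‖mfderiv 𝓘(ℝ, ℝ) 𝕀 γ t 1‖ₑ
              = ‖(symmD q (η t) (b - a) : TangentSpace 𝕀 ((extChartAt 𝕀 q).symm (η t)))‖ₑ :=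
            congrArg _ h2
          rw [h7, ← ofReal_norm]
          exact ENNReal.ofReal_le_ofReal h6
      _ = ENNReal.ofReal K := by simp
  exact (ENNReal.ofReal_le_ofReal_iff hK).1 hdist

/-- A ball in a chart on which the metric is comparable to the metric at its center. -/
theorem exists_chart_ball (q : X) : ∃ ρ > 0,
    Metric.ball (extChartAt 𝕀 q q) ρ ⊆ (extChartAt 𝕀 q).target ∧
    (∀ y ∈ Metric.ball (extChartAt 𝕀 q q) ρ, ∀ v,
      chartMetric q (extChartAt 𝕀 q q) v v ≤ 4 * chartMetric q y v v) ∧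
    ∀ a ∈ Metric.ball (extChartAt 𝕀 q q) ρ, ∀ b ∈ Metric.ball (extChartAt 𝕀 q q) ρ,
      dist ((extChartAt 𝕀 q).symm a) ((extChartAt 𝕀 q).symm b)
        ≤ 2 * √(chartMetric q (extChartAt 𝕀 q q) (b - a) (b - a)) := by
  have hmem := mem_extChartAt_target (I := 𝕀) q
  have hG := isMetricOn_chartMetric (n := n) q
  obtain ⟨ρ, hρ, hsub⟩ := Metric.mem_nhds_iff.1
    (inter_mem ((isOpen_extChartAt_target q).mem_nhds hmem) (hG.eventually_comparison hmem))
  refine ⟨ρ, hρ, fun y hy => (hsub hy).1, fun y hy v => ((hsub hy).2 v).2, fun a ha b hb => ?_⟩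
  have hseg := (convex_ball (extChartAt 𝕀 q q) ρ).segment_subset ha hb
  refine dist_symm_le q (by positivity) (fun y hy => (hsub (hseg hy)).1) fun y hy => ?_
  have h0 : 0 ≤ chartMetric q (extChartAt 𝕀 q q) (b - a) (b - a) := by
    rw [chartMetric_apply]
    exact real_inner_self_nonneg
  rw [mul_pow, Real.sq_sqrt h0]
  linarith [((hsub (hseg hy)).2 (b - a)).1]

theorem exists_lipschitz_chart_ball (q : X) : ∃ ρ > 0, ∃ C : NNReal,
    Metric.ball (extChartAt 𝕀 q q) ρ ⊆ (extChartAt 𝕀 q).target ∧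
    LipschitzOnWith C (extChartAt 𝕀 q).symm (Metric.ball (extChartAt 𝕀 q q) ρ) := by
  obtain ⟨ρ, hρ, hsub, -, hdist⟩ := exists_chart_ball (n := n) q
  set B := chartMetric q (extChartAt 𝕀 q q)
  refine ⟨ρ, hρ, ⟨2 * √‖B‖, by positivity⟩, hsub, LipschitzOnWith.of_dist_le_mul ?_⟩
  intro a ha b hb
  refine (hdist a ha b hb).trans ?_
  change _ ≤ 2 * √‖B‖ * dist a b
  rw [mul_assoc, dist_comm, dist_eq_norm]
  gcongr
  rw [Real.sqrt_le_left (by positivity), mul_pow, Real.sq_sqrt (norm_nonneg _)]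
  calc B (b - a) (b - a) ≤ ‖B (b - a) (b - a)‖ := le_abs_self _
    _ ≤ ‖B‖ * ‖b - a‖ * ‖b - a‖ := B.le_opNorm₂ _ _
    _ = _ := by ring

end LocalDistance

/-! ### Local finiteness of volume and boundary area -/

section HausdorffFinite

theorem euclideanHausdorffMeasure_lt_top {Y : Type*} [EMetricSpace Y] [MeasurableSpace Y]
    [BorelSpace Y] {d : ℕ} {s : Set Y} (h : (μH[d] : Measure Y) s < ⊤) :
    (μHE[d] : Measure Y) s < ⊤ := by
  rw [Measure.euclideanHausdorffMeasure_def, Measure.smul_apply, ENNReal.smul_def, smul_eq_mul]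
  exact ENNReal.mul_lt_top ENNReal.coe_lt_top h

theorem hausdorffMeasure_image_lt_top {Y Z : Type*} [EMetricSpace Y] [MeasurableSpace Y]
    [BorelSpace Y] [EMetricSpace Z] [MeasurableSpace Z] [BorelSpace Z] {f : Y → Z} {s : Set Y}
    {C : NNReal} (hf : LipschitzOnWith C f s) {d : ℕ} (h : (μH[d] : Measure Y) s < ⊤) :
    (μH[d] : Measure Z) (f '' s) < ⊤ := by
  refine (hf.hausdorffMeasure_image_le (Nat.cast_nonneg d)).trans_lt (ENNReal.mul_lt_top ?_ h)
  exact ENNReal.rpow_lt_top_of_nonneg (Nat.cast_nonneg d) ENNReal.coe_ne_top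

variable {E : Type*} [NormedAddCommGroup E] [NormedSpace ℝ E] [FiniteDimensional ℝ E]
  [MeasurableSpace E] [BorelSpace E]

theorem hausdorffMeasure_lt_top_of_isBounded {d : ℕ} (hd : Module.finrank ℝ E = d) {s : Set E}
    (hs : Bornology.IsBounded s) : (μH[d] : Measure E) s < ⊤ := by
  subst hd
  exact hs.measure_lt_top

/-- Near a regular point, a level set has finite Hausdorff measure of codimension one. -/
theorem exists_hausdorffMeasure_levelSet_lt_top {d : ℕ} (hd : Module.finrank ℝ E = d + 1)
    {ψ : E → ℝ} {L : E →L[ℝ] ℝ} {y₀ : E} (hψ : HasStrictFDerivAt ψ L y₀) (hL : L ≠ 0) :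
    ∃ ρ > 0, (μH[d] : Measure E) {y ∈ Metric.ball y₀ ρ | ψ y = 0} < ⊤ := by
  obtain ⟨e, he⟩ : ∃ e, L e = 1 := by
    obtain ⟨v, hv⟩ : ∃ v, L v ≠ 0 := by
      by_contra! h
      exact hL (ContinuousLinearMap.ext h)
    exact ⟨(L v)⁻¹ • v, by simp [hv]⟩
  -- This accuracy in strict differentiability makes `|L v| ‖e‖ ≤ ‖v‖ / 2` for differences `v` of
  -- points of the level set. Projection along `e` onto `L.ker` then shrinks distances by at most a
  -- factor 2, and its image is a bounded subset of a `d`-dimensional space.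
  have hpos : 0 < (2 * (‖e‖ + 1))⁻¹ := by positivity
  obtain ⟨ρ, hρ, hball⟩ := Metric.eventually_nhds_iff_ball.1 (hψ.isLittleO.def hpos)
  have hball' : ∀ a ∈ Metric.ball y₀ ρ, ∀ b ∈ Metric.ball y₀ ρ,
      |ψ a - ψ b - L (a - b)| ≤ (2 * (‖e‖ + 1))⁻¹ * ‖a - b‖ := by
    intro a ha b hb
    refine hball (a, b) ?_
    rw [← ball_prod_same]
    exact ⟨ha, hb⟩
  set Z : Set E := {y ∈ Metric.ball y₀ ρ | ψ y = 0} with hZ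
  refine ⟨ρ, hρ, ?_⟩
  let pr : E →L[ℝ] L.ker := (ContinuousLinearMap.id ℝ E - L.smulRight e).codRestrict _
    (fun v => by simp [he])
  have hpr : ∀ v, ((pr v : L.ker) : E) = v - L v • e := fun v => rfl
  have hanti : AntilipschitzWith 2 (fun z : Z => pr z) := by
    refine AntilipschitzWith.of_le_mul_dist fun a b => ?_
    have h1 := hball' a a.2.1 b b.2.1
    rw [a.2.2, b.2.2, sub_zero, zero_sub, abs_neg] at h1
    rw [Subtype.dist_eq, Subtype.dist_eq, dist_eq_norm, dist_eq_norm, ← Submodule.coe_sub,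
      ← map_sub, hpr]
    set v : E := (a : E) - b
    have h2 : ‖v‖ ≤ ‖v - L v • e‖ + |L v| * ‖e‖ := by
      calc ‖v‖ = ‖(v - L v • e) + L v • e‖ := by simp
        _ ≤ _ := (norm_add_le _ _).trans (by rw [norm_smul, Real.norm_eq_abs])
    have h3 : |L v| * ‖e‖ ≤ ‖v‖ / 2 := by
      calc |L v| * ‖e‖ ≤ ((2 * (‖e‖ + 1))⁻¹ * ‖v‖) * (‖e‖ + 1) := by
            gcongr
            linarith
        _ = ‖v‖ / 2 := by field_simp
    change ‖v‖ ≤ 2 * ‖v - L v • e‖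
    linarith
  have hker : Module.finrank ℝ L.ker = d := by
    have h1 := LinearMap.finrank_range_add_finrank_ker (L : E →ₗ[ℝ] ℝ)
    have h2 : LinearMap.range (L : E →ₗ[ℝ] ℝ) = ⊤ := by
      rw [LinearMap.range_eq_top]
      intro t
      exact ⟨t • e, by simp [he]⟩
    rw [h2, finrank_top, Module.finrank_self, hd] at h1
    have h3 : Module.finrank ℝ L.ker = Module.finrank ℝ (LinearMap.ker (L : E →ₗ[ℝ] ℝ)) := rfl
    omega
  have hbdd : Bornology.IsBounded ((fun z : Z => pr z) '' univ) := by
    have h1 : (fun z : Z => pr z) '' univ ⊆ pr '' Metric.ball y₀ ρ := by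
      rintro _ ⟨z, -, rfl⟩
      exact ⟨z, z.2.1, rfl⟩
    exact (Metric.isBounded_ball.image pr).subset h1
  have h1 := (hanti.le_hausdorffMeasure_image (Nat.cast_nonneg d) univ).trans_lt
    (ENNReal.mul_lt_top (ENNReal.rpow_lt_top_of_nonneg (Nat.cast_nonneg d) ENNReal.coe_ne_top)
      (hausdorffMeasure_lt_top_of_isBounded hker hbdd))
  have h2 := (isometry_subtype_coe (s := Z)).hausdorffMeasure_image
    (Or.inl (Nat.cast_nonneg d)) univ
  rw [image_univ, Subtype.range_coe] at h2
  rwa [h2]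

end HausdorffFinite

section ManifoldMeasure

variable {n : ℕ} {X : Type*} [MetricSpace X] [MeasurableSpace X] [BorelSpace X]
  [ChartedSpace (EuclideanSpace ℝ (Fin (n + 1))) X]
  [IsManifold (𝓡 (n + 1)) ∞ X] [RiemannianBundle (fun x : X => TangentSpace (𝓡 (n + 1)) x)]
  [IsContMDiffRiemannianBundle (𝓡 (n + 1)) ∞ (EuclideanSpace ℝ (Fin (n + 1)))
      (fun x : X => TangentSpace (𝓡 (n + 1)) x)]
  [IsRiemannianManifold (𝓡 (n + 1)) X]

local notation "𝔼" => EuclideanSpace ℝ (Fin (n + 1))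
local notation "𝕀" => 𝓡 (n + 1)

theorem image_chart_ball_mem_nhds (q : X) {ρ : ℝ} (hρ : 0 < ρ) :
    (extChartAt 𝕀 q).symm '' Metric.ball (extChartAt 𝕀 q q) ρ ∈ 𝓝 q := by
  filter_upwards [extChartAt_source_mem_nhds (I := 𝕀) q,
    (continuousAt_extChartAt (I := 𝕀) q).preimage_mem_nhds (Metric.ball_mem_nhds _ hρ)] with p hp hp'
  exact ⟨_, hp', (extChartAt 𝕀 q).left_inv hp⟩

/-- Near each point the manifold is a Lipschitz image of a Euclidean ball, and Lipschitz maps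
preserve finiteness of Hausdorff measure. -/
theorem isLocallyFiniteMeasure_volume :
    IsLocallyFiniteMeasure (μHE[n + 1] : Measure X) := by
  refine ⟨fun q => ?_⟩
  obtain ⟨ρ, hρ, C, -, hlip⟩ := exists_lipschitz_chart_ball (n := n) q
  refine ⟨_, image_chart_ball_mem_nhds (n := n) q hρ, euclideanHausdorffMeasure_lt_top ?_⟩
  exact hausdorffMeasure_image_lt_top hlip
    (hausdorffMeasure_lt_top_of_isBounded (by simp) Metric.isBounded_ball)

/-- A negative value would put the point inside the open set `Ω`; a positive one would give a
neighbourhood missing `Ω`. -/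
theorem frontier_inter_subset_levelSet {Ω U : Set X} (hΩ : IsOpen Ω) (hU : IsOpen U) {φ : X → ℝ}
    (hφ : ContinuousOn φ U) (h : Ω ∩ U = {q ∈ U | φ q < 0}) : ∀ p ∈ frontier Ω ∩ U, φ p = 0 := by
  rintro p ⟨hp, hpU⟩
  rw [hΩ.frontier_eq] at hp
  by_contra hne
  obtain hlt | hgt := lt_or_gt_of_ne hne
  · have : p ∈ Ω ∩ U := by
      rw [h]
      exact ⟨hpU, hlt⟩
    exact hp.2 this.1
  · have h1 : ∀ᶠ x in 𝓝 p, x ∈ U ∧ 0 < φ x :=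
      (hU.eventually_mem hpU).and
        ((hφ.continuousAt (hU.mem_nhds hpU)).eventually_const_lt hgt)
    obtain ⟨x, hx, hxU, hx0⟩ := ((mem_closure_iff_frequently.1 hp.1).and_eventually h1).exists
    have : x ∈ {q ∈ U | φ q < 0} := by
      rw [← h]
      exact ⟨hx, hxU⟩
    exact lt_asymm this.2 hx0

/-- The area of the boundary is locally finite. -/
theorem isLocallyFiniteMeasure_area {Ω : Set X} (hΩ : IsOpen Ω) (hb : HasSmoothBoundary n Ω) :
    IsLocallyFiniteMeasure ((μHE[n] : Measure X).restrict (frontier Ω)) := by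
  refine ⟨fun q => ?_⟩
  suffices ∃ s ∈ 𝓝 q, (μHE[n] : Measure X) (s ∩ frontier Ω) < ⊤ by
    obtain ⟨s, hs, hlt⟩ := this
    exact ⟨s, hs, by rwa [Measure.restrict_apply' isClosed_frontier.measurableSet]⟩
  by_cases hq : q ∈ frontier Ω
  swap
  · exact ⟨(frontier Ω)ᶜ, isClosed_frontier.isOpen_compl.mem_nhds hq, by simp⟩
  obtain ⟨U, hU, hqU, φ, hφ, hreg, hset⟩ := hb q hq
  have hlevel := frontier_inter_subset_levelSet hΩ hU hφ.continuousOn hset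
  obtain ⟨ρ, hρ, C, -, hlip⟩ := exists_lipschitz_chart_ball (n := n) q
  have hφq : ContMDiffAt 𝕀 𝓘(ℝ, ℝ) ∞ φ q := hφ.contMDiffAt (hU.mem_nhds hqU)
  have hcd : ContDiffAt ℝ ∞ (φ ∘ (extChartAt 𝕀 q).symm) (extChartAt 𝕀 q q) := by
    rw [← contMDiffAt_iff_contDiffAt]
    refine ContMDiffAt.comp _ ?_ ((contMDiffOn_extChartAt_symm q).contMDiffAt
      ((isOpen_extChartAt_target q).mem_nhds (mem_extChartAt_target q)))
    rwa [extChartAt_to_inv]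
  have hL : fderiv ℝ (φ ∘ (extChartAt 𝕀 q).symm) (extChartAt 𝕀 q q) ≠ 0 := by
    intro h0
    apply hreg q hqU
    ext v
    refine (mfderiv_eq_fderiv_chart q (mem_extChartAt_source q)
      (hφq.mdifferentiableAt (by simp)) v).trans ?_
    rw [h0]
    rfl
  obtain ⟨ρ', hρ', hfin⟩ := exists_hausdorffMeasure_levelSet_lt_top (d := n) (by simp)
    (hcd.hasStrictFDerivAt (by simp)) hL
  have hmin : 0 < min ρ ρ' := lt_min hρ hρ'
  have hsubρ : Metric.ball (extChartAt 𝕀 q q) (min ρ ρ') ⊆ Metric.ball (extChartAt 𝕀 q q) ρ :=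
    Metric.ball_subset_ball (min_le_left _ _)
  refine ⟨_, inter_mem (image_chart_ball_mem_nhds (n := n) q hmin) (hU.mem_nhds hqU), ?_⟩
  set Z : Set 𝔼 := {y ∈ Metric.ball (extChartAt 𝕀 q q) (min ρ ρ') |
    (φ ∘ (extChartAt 𝕀 q).symm) y = 0} with hZ
  have hZfin : (μH[n] : Measure 𝔼) Z < ⊤ :=
    (measure_mono (show Z ⊆ {y ∈ Metric.ball (extChartAt 𝕀 q q) ρ' |
      (φ ∘ (extChartAt 𝕀 q).symm) y = 0} from fun y hy =>
      ⟨Metric.ball_subset_ball (min_le_right _ _) hy.1, hy.2⟩)).trans_lt hfin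
  have hZlip : LipschitzOnWith C (extChartAt 𝕀 q).symm Z := hlip.mono fun y hy => hsubρ hy.1
  refine (measure_mono ?_).trans_lt
    (euclideanHausdorffMeasure_lt_top (hausdorffMeasure_image_lt_top hZlip hZfin))
  rintro _ ⟨⟨⟨y, hy, rfl⟩, hyU⟩, hyf⟩
  exact ⟨y, ⟨hy, hlevel _ ⟨hyf, hyU⟩⟩, rfl⟩

end ManifoldMeasure

/-! ### Smoothing Lipschitz functions with gradient control -/

/-- Mollification preserves local Lipschitz bounds in any seminorm. -/
theorem exists_contDiff_approx {E : Type*} [NormedAddCommGroup E] [InnerProductSpace ℝ E]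
    [FiniteDimensional ℝ E] [MeasurableSpace E] [BorelSpace E] {F : E → ℝ} {C : NNReal}
    (hF : LipschitzWith C F) {N : E → ℝ} {c : E} {ρ : ℝ} (hρ : 0 < ρ)
    (hN : ∀ a ∈ Metric.ball c ρ, ∀ b ∈ Metric.ball c ρ, |F a - F b| ≤ N (a - b))
    {δ : ℝ} (hδ : 0 < δ) :
    ∃ h : E → ℝ, ContDiff ℝ ∞ h ∧ (∀ y, |h y - F y| ≤ δ) ∧
      ∀ a ∈ Metric.ball c (ρ / 2), ∀ b ∈ Metric.ball c (ρ / 2), |h a - h b| ≤ N (a - b) := by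
  -- The first bound keeps translates of the half ball inside the ball where `hN` holds; the second
  -- makes the error at most `δ`.
  set s : ℝ := min (ρ / 2) (δ / (C + 1)) with hs
  have hs0 : 0 < s := lt_min (by positivity) (by positivity)
  let φ : ContDiffBump (0 : E) := ⟨s / 2, s, by positivity, by linarith⟩
  have hint := hF.continuous.locallyIntegrable (μ := volume)
  set ψ := φ.normed volume with hψ
  refine ⟨convolution ψ F (ContinuousLinearMap.lsmul ℝ ℝ) volume,
    φ.hasCompactSupport_normed.contDiff_convolution_left _ φ.contDiff_normed hint, ?_, ?_⟩
  · intro y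
    rw [← Real.dist_eq]
    refine ContDiffBump.dist_normed_convolution_le hF.continuous.aestronglyMeasurable ?_
    intro x hx
    refine (hF.dist_le_mul x y).trans ?_
    have h1 : dist x y ≤ δ / (C + 1) := (Metric.mem_ball.1 hx).le.trans (min_le_right _ _)
    have h2 : (0 : ℝ) ≤ C := C.2
    calc (C : ℝ) * dist x y ≤ (C + 1) * (δ / (C + 1)) := by gcongr; linarith
      _ = δ := by field_simp
  · intro a ha b hb
    have hex := (φ.hasCompactSupport_normed (μ := volume)).convolutionExists_left
      (μ := (volume : Measure E)) (ContinuousLinearMap.lsmul ℝ ℝ)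
      (φ.contDiff_normed (n := 0)).continuous hint
    rw [convolution_def, convolution_def, ← integral_sub (hex a) (hex b), ← Real.norm_eq_abs]
    have hbd : ∀ t, ‖ψ t • F (a - t) - ψ t • F (b - t)‖ ≤ ψ t * N (a - b) := by
      intro t
      rw [← smul_sub, norm_smul, Real.norm_of_nonneg (φ.nonneg_normed t), Real.norm_eq_abs]
      by_cases ht : t ∈ Metric.ball (0 : E) s
      · refine mul_le_mul_of_nonneg_left ?_ (φ.nonneg_normed t)
        have htn : ‖t‖ < ρ / 2 := (mem_ball_zero_iff.1 ht).trans_le (min_le_left _ _)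
        have key : ∀ z ∈ Metric.ball c (ρ / 2), z - t ∈ Metric.ball c ρ := by
          intro z hz
          rw [mem_ball_iff_norm] at hz ⊢
          calc ‖z - t - c‖ = ‖(z - c) - t‖ := by congr 1; abel
            _ ≤ ‖z - c‖ + ‖t‖ := norm_sub_le _ _
            _ < ρ := by linarith
        have := hN _ (key a ha) _ (key b hb)
        rwa [sub_sub_sub_cancel_right] at this
      · have : φ.normed volume t = 0 := by
          rw [← Function.notMem_support, φ.support_normed_eq]
          exact ht
        simp [hψ, this]
    calc ‖∫ t, ψ t • F (a - t) - ψ t • F (b - t)‖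
        ≤ ∫ t, ψ t * N (a - b) :=
          norm_integral_le_of_norm_le (φ.integrable_normed.mul_const _)
            (Eventually.of_forall hbd)
      _ = N (a - b) := by rw [integral_mul_const, φ.integral_normed, one_mul]

section LocalSmoothing

variable {n : ℕ} {X : Type*} [MetricSpace X] [ChartedSpace (EuclideanSpace ℝ (Fin (n + 1))) X]
  [IsManifold (𝓡 (n + 1)) ∞ X] [RiemannianBundle (fun x : X => TangentSpace (𝓡 (n + 1)) x)]
  [IsContMDiffRiemannianBundle (𝓡 (n + 1)) ∞ (EuclideanSpace ℝ (Fin (n + 1)))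
      (fun x : X => TangentSpace (𝓡 (n + 1)) x)]
  [IsRiemannianManifold (𝓡 (n + 1)) X]

local notation "𝔼" => EuclideanSpace ℝ (Fin (n + 1))
local notation "𝕀" => 𝓡 (n + 1)

/-- Near any point, a `1`-Lipschitz function is uniformly approximated by smooth functions with
bounded gradient, on a neighbourhood that does not depend on the accuracy. -/
theorem exists_local_smoothing {d : X → ℝ} (hd : LipschitzWith 1 d) (q : X) :
    ∃ U : Set X, IsOpen U ∧ q ∈ U ∧ (∃ K, IsCompact K ∧ U ⊆ K) ∧ ∀ δ > 0, ∃ h : X → ℝ,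
      ContMDiffOn 𝕀 𝓘(ℝ, ℝ) ∞ h U ∧ ∀ p ∈ U, |h p - d p| ≤ δ ∧ gradNorm n h p ≤ 4 := by
  obtain ⟨ρ, hρ, htarget, hcmp, hdist⟩ := exists_chart_ball (n := n) q
  obtain ⟨ρ', hρ', C, -, hlip⟩ := exists_lipschitz_chart_ball (n := n) q
  set y₀ := extChartAt 𝕀 q q with hy₀
  set B := chartMetric q y₀ with hB
  set σ := min ρ ρ' with hσ
  have hσ0 : 0 < σ := lt_min hρ hρ'
  have hsub : Metric.ball y₀ σ ⊆ Metric.ball y₀ ρ := Metric.ball_subset_ball (min_le_left _ _)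
  have hsub' : Metric.ball y₀ σ ⊆ Metric.ball y₀ ρ' := Metric.ball_subset_ball (min_le_right _ _)
  have hhalf : Metric.ball y₀ (σ / 2) ⊆ Metric.ball y₀ σ :=
    Metric.ball_subset_ball (by linarith)
  -- Convolution needs a function on the whole model space. The sharper bound in the seminorm of `B`
  -- is only available, and only needed, on the ball.
  obtain ⟨F, hF, hFeq⟩ := ((hd.comp_lipschitzOnWith hlip).mono hsub').extend_real
  have hN : ∀ a ∈ Metric.ball y₀ σ, ∀ b ∈ Metric.ball y₀ σ,
      |F a - F b| ≤ 2 * √(B (a - b) (a - b)) := by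
    intro a ha b hb
    rw [← hFeq ha, ← hFeq hb, ← Real.dist_eq]
    refine (hd.dist_le_mul _ _).trans ?_
    rw [NNReal.coe_one, one_mul, dist_comm]
    exact hdist b (hsub hb) a (hsub ha)
  refine ⟨(extChartAt 𝕀 q).source ∩ extChartAt 𝕀 q ⁻¹' Metric.ball y₀ (σ / 2),
    isOpen_extChartAt_preimage' q Metric.isOpen_ball,
    ⟨mem_extChartAt_source q, Metric.mem_ball_self (by positivity)⟩,
    ⟨(extChartAt 𝕀 q).symm '' Metric.closedBall y₀ (σ / 2), ?_, ?_⟩, ?_⟩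
  · refine (isCompact_closedBall _ _).image_of_continuousOn
      ((continuousOn_extChartAt_symm q).mono ?_)
    exact (Metric.closedBall_subset_ball (by linarith)).trans (hsub.trans htarget)
  · rintro p ⟨hp, hpb⟩
    exact ⟨_, Metric.ball_subset_closedBall hpb, (extChartAt 𝕀 q).left_inv hp⟩
  intro δ hδ
  obtain ⟨h, hh, hclose, hhN⟩ := exists_contDiff_approx hF
    (N := fun v => 2 * √(B v v)) hσ0 hN hδ
  refine ⟨fun p => h (extChartAt 𝕀 q p), ?_, ?_⟩
  · exact hh.contMDiff.comp_contMDiffOn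
      (((contMDiffOn_extChartAt (I := 𝕀) (n := ∞) (x := q)).mono fun p hp => by
        rw [← extChartAt_source (I := 𝕀)]; exact hp.1))
  rintro p ⟨hp, hpb⟩
  have hpb' : extChartAt 𝕀 q p ∈ Metric.ball y₀ (σ / 2) := hpb
  refine ⟨?_, ?_⟩
  · have h1 := hclose (extChartAt 𝕀 q p)
    rw [← hFeq (hhalf hpb), Function.comp_apply, (extChartAt 𝕀 q).left_inv hp] at h1
    exact h1
  have hfd : ∀ v : 𝔼, |fderiv ℝ h (extChartAt 𝕀 q p) v| ≤ 2 * √(B v v) := by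
    intro v
    have h1 : HasDerivAt (fun t : ℝ => h (extChartAt 𝕀 q p + t • v))
        (fderiv ℝ h (extChartAt 𝕀 q p) v) 0 := by
      have h2 : HasDerivAt (fun t : ℝ => extChartAt 𝕀 q p + t • v) v 0 := by
        simpa using ((hasDerivAt_id (0 : ℝ)).smul_const v).const_add (extChartAt 𝕀 q p)
      have h3 : HasFDerivAt h (fderiv ℝ h (extChartAt 𝕀 q p))
          (extChartAt 𝕀 q p + (0 : ℝ) • v) := by
        rw [zero_smul, add_zero]
        exact (hh.differentiable (by simp)).differentiableAt.hasFDerivAt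
      exact h3.comp_hasDerivAt 0 h2
    rw [← Real.norm_eq_abs]
    refine h1.le_of_lip' (by positivity) ?_
    have hc : ContinuousAt (fun t : ℝ => extChartAt 𝕀 q p + t • v) 0 := by fun_prop
    have hnear := hc.preimage_mem_nhds
      (Metric.isOpen_ball.mem_nhds (x := extChartAt 𝕀 q p + (0 : ℝ) • v)
        (by simpa using hpb'))
    filter_upwards [hnear] with t ht
    have h4 := hhN _ ht _ hpb'
    simp only [add_sub_cancel_left, map_smul, smul_apply, smul_eq_mul] at h4
    simp only [zero_smul, add_zero, sub_zero, Real.norm_eq_abs]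
    refine h4.trans (le_of_eq ?_)
    rw [← mul_assoc t t, Real.sqrt_mul (mul_self_nonneg t), Real.sqrt_mul_self_eq_abs]
    ring
  have hmd : HasMFDerivAt 𝕀 𝓘(ℝ, ℝ) (fun p => h (extChartAt 𝕀 q p)) p
      ((fderiv ℝ h (extChartAt 𝕀 q p)).comp (chartD n q p)) :=
    ((hh.differentiable (by simp)).differentiableAt.hasFDerivAt.hasMFDerivAt).comp p
      (mdifferentiableAt_chart q hp).hasMFDerivAt
  rw [gradNorm_eq_of_hasMFDerivAt hmd]
  refine norm_covector_le (by norm_num) fun v => ?_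
  refine (hfd (chartD n q p v)).trans ?_
  have h5 := hcmp _ (hsub (hhalf hpb')) (chartD n q p v)
  rw [chartMetric_chartD q hp] at h5
  -- The constant 4 is `2 · 2`: one factor from distance against `B`, one from `B` against the
  -- metric at `p`.
  calc 2 * √(B (chartD n q p v) (chartD n q p v)) ≤ 2 * √(2 ^ 2 * inner ℝ v v) := by
        gcongr
        linarith
    _ = 4 * √(inner ℝ v v) := by
        rw [Real.sqrt_mul (by positivity), Real.sqrt_sq (by norm_num)]
        ring

end LocalSmoothing

/-! ### Partitions of unity and global smoothing -/

section Partition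

variable {n : ℕ} {X : Type*} [MetricSpace X] [ChartedSpace (EuclideanSpace ℝ (Fin (n + 1))) X]
  [IsManifold (𝓡 (n + 1)) ∞ X] [RiemannianBundle (fun x : X => TangentSpace (𝓡 (n + 1)) x)]

local notation "𝔼" => EuclideanSpace ℝ (Fin (n + 1))
local notation "𝕀" => 𝓡 (n + 1)

/-- The differential of a real function, as a covector. -/
def differential (f : X → ℝ) (p : X) : TangentSpace 𝕀 p →L[ℝ] ℝ := mfderiv 𝕀 𝓘(ℝ, ℝ) f p

theorem gradNorm_eq_differential (f : X → ℝ) (p : X) :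
    gradNorm n f p = ‖covector p (differential (n := n) f p)‖ := by
  rw [EuclideanSpace.norm_eq]
  simp only [gradNorm, covector, Real.norm_eq_abs, sq_abs]
  rfl

theorem differential_eq_zero_of_notMem_tsupport {f : X → ℝ} {p : X} (hp : p ∉ tsupport f) :
    HasMFDerivAt 𝕀 𝓘(ℝ, ℝ) f p (0 : TangentSpace 𝕀 p →L[ℝ] ℝ) :=
  (hasMFDerivAt_const (0 : ℝ) p).congr_of_eventuallyEq (notMem_tsupport_iff_eventuallyEq.1 hp)

theorem gradNorm_eq_zero_of_hasMFDerivAt_zero {f : X → ℝ} {p : X}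
    (h : HasMFDerivAt 𝕀 𝓘(ℝ, ℝ) f p (0 : TangentSpace 𝕀 p →L[ℝ] ℝ)) : gradNorm n f p = 0 := by
  rw [gradNorm_eq_of_hasMFDerivAt h, map_zero, norm_zero]

theorem gradNorm_eq_zero_of_notMem_tsupport {f : X → ℝ} {p : X} (hp : p ∉ tsupport f) :
    gradNorm n f p = 0 :=
  gradNorm_eq_zero_of_hasMFDerivAt_zero (differential_eq_zero_of_notMem_tsupport hp)

/-- The differential of a function patched together by a partition of unity. -/
theorem hasMFDerivAt_partition_finsum {f : SmoothPartitionOfUnity ℕ 𝕀 X univ} {U : ℕ → Set X}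
    (hf : f.IsSubordinate U) (hU : ∀ i, IsOpen (U i)) {h : ℕ → X → ℝ}
    (hh : ∀ i, ContMDiffOn 𝕀 𝓘(ℝ, ℝ) ∞ (h i) (U i)) (p : X) :
    HasMFDerivAt 𝕀 𝓘(ℝ, ℝ) (fun x => ∑ᶠ i, f i x • h i x) p
      (∑ i ∈ f.fintsupport p, (f i p • differential (n := n) (h i) p
        + h i p • differential (n := n) (f i) p)) := by
  have h1 : ∀ i ∈ f.fintsupport p, HasMFDerivAt 𝕀 𝓘(ℝ, ℝ) ((f i : X → ℝ) * h i) p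
      (f i p • differential (n := n) (h i) p + h i p • differential (n := n) (f i) p) := by
    intro i hi
    have hpi : p ∈ U i := hf i ((f.mem_fintsupport_iff p i).1 hi)
    have h2 := (((hh i).contMDiffAt ((hU i).mem_nhds hpi)).mdifferentiableAt
      (by simp)).hasMFDerivAt
    have h3 := ((f i).contMDiff.mdifferentiableAt (x := p) (by simp)).hasMFDerivAt
    exact h3.mul h2
  refine (HasMFDerivAt.sum h1).congr_of_eventuallyEq ?_
  filter_upwards [f.eventually_finsupport_subset p] with x hx
  rw [finsum_eq_sum_of_support_subset _ (s := f.fintsupport p) ?_]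
  · simp
  · intro i hi
    refine hx ((f.mem_finsupport x).2 ?_)
    rw [Function.mem_support] at hi ⊢
    exact left_ne_zero_of_smul hi

/-- The identity `∑ fᵢ = 1`, differentiated. It allows a common value to be subtracted from all
local approximations in the gradient of a glued function. -/
theorem sum_differential_partition {f : SmoothPartitionOfUnity ℕ 𝕀 X univ} (p : X) :
    ∑ i ∈ f.fintsupport p, differential (n := n) (f i) p = 0 := by
  have h1 := hasMFDerivAt_partition_finsum (f := f) (U := fun _ => univ) (fun i => subset_univ _)
    (fun _ => isOpen_univ) (h := fun _ _ => (1 : ℝ)) (fun _ => contMDiffOn_const) p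
  have h2 : (fun x => ∑ᶠ i, f i x • (1 : ℝ)) = fun _ => (1 : ℝ) := by
    ext x
    simpa using f.sum_eq_one (mem_univ x)
  rw [h2] at h1
  have h3 : differential (n := n) (fun _ : X => (1 : ℝ)) p = 0 :=
    (hasMFDerivAt_const (1 : ℝ) p).mfderiv
  have h4 : ∑ i ∈ f.fintsupport p, (f i p • differential (n := n) (fun _ : X => (1 : ℝ)) p
      + (1 : ℝ) • differential (n := n) (f i) p) = 0 :=
    hasMFDerivAt_unique h1 (hasMFDerivAt_const (1 : ℝ) p)
  simpa [h3] using h4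

variable [IsContMDiffRiemannianBundle (𝓡 (n + 1)) ∞ (EuclideanSpace ℝ (Fin (n + 1)))
      (fun x : X => TangentSpace (𝓡 (n + 1)) x)]

theorem exists_gradNorm_le {f : X → ℝ} (hf : ContMDiff 𝕀 𝓘(ℝ, ℝ) ∞ f) (hc : HasCompactSupport f) :
    ∃ M, 0 ≤ M ∧ ∀ p, gradNorm n f p ≤ M := by
  obtain ⟨M, hM⟩ := hc.isCompact.exists_bound_of_continuousOn (continuous_gradNorm hf).continuousOn
  refine ⟨max M 0, le_max_right _ _, fun p => ?_⟩
  by_cases hp : p ∈ tsupport f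
  · exact (le_abs_self _).trans ((hM p hp).trans (le_max_left _ _))
  · rw [gradNorm_eq_zero_of_notMem_tsupport hp]
    exact le_max_right _ _

/-- Indexing by `ℕ` makes the geometric weights `2 ^ (-i)` available for summing errors. -/
theorem exists_partition [SecondCountableTopology X] [Nonempty X] {U : X → Set X}
    (hU : ∀ q, IsOpen (U q)) (hmem : ∀ q, q ∈ U q) :
    ∃ (c : ℕ → X) (f : SmoothPartitionOfUnity ℕ 𝕀 X univ), f.IsSubordinate fun i => U (c i) := by
  have : LocallyCompactSpace X := ChartedSpace.locallyCompactSpace 𝔼 X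
  obtain ⟨s, hs, hcov⟩ := TopologicalSpace.countable_cover_nhds
    (fun q => (hU q).mem_nhds (hmem q))
  have hne : s.Nonempty := by
    by_contra h
    rw [not_nonempty_iff_eq_empty] at h
    subst h
    simp at hcov
    exact (empty_ne_univ hcov).elim
  obtain ⟨c, rfl⟩ := hs.exists_eq_range hne
  refine ⟨c, SmoothPartitionOfUnity.exists_isSubordinate 𝕀 isClosed_univ _ (fun i => hU (c i)) ?_⟩
  rw [← hcov]
  simp

theorem sum_half_pow_le (s : Finset ℕ) {a : ℝ} (ha : 0 ≤ a) : ∑ i ∈ s, a / 2 / 2 ^ i ≤ a :=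
  sum_le_hasSum s (fun i _ => by positivity) (hasSum_geometric_two' a)

/-- Local smoothings `hᵢ` are glued by a partition of unity. The gradient is `∑ fᵢ ∇hᵢ + ∑ (hᵢ - d)
∇fᵢ`; the first sum has norm at most 4, and the second at most 1 if each `hᵢ` is accurate enough
relative to `∇fᵢ`. -/
theorem exists_smoothing [SecondCountableTopology X] [IsRiemannianManifold (𝓡 (n + 1)) X]
    {d : X → ℝ} (hd : LipschitzWith 1 d) {ε : ℝ} (hε : 0 < ε) :
    ∃ g : X → ℝ, ContMDiff 𝕀 𝓘(ℝ, ℝ) ∞ g ∧ ∀ p, |g p - d p| ≤ ε ∧ gradNorm n g p ≤ 5 := by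
  rcases isEmpty_or_nonempty X with hX | hX
  · exact ⟨fun _ => 0, contMDiff_const, fun p => (hX.false p).elim⟩
  choose U hU hmem hK hloc using fun q => exists_local_smoothing (n := n) hd q
  choose K hK hUK using hK
  obtain ⟨c, f, hf⟩ := exists_partition (n := n) hU hmem
  have hcs : ∀ i, HasCompactSupport (f i) := fun i =>
    (hK (c i)).of_isClosed_subset (isClosed_tsupport _) ((hf i).trans (hUK (c i)))
  choose M hM0 hM using fun i => exists_gradNorm_le (n := n) (f i).contMDiff (hcs i)
  -- The accuracy depends on the gradient bound `M i` of the partition. This is not circular, since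
  -- the neighbourhoods, and hence the partition, were fixed independently of the accuracy.
  let δ : ℕ → ℝ := fun i => min ε (1 / 2 / 2 ^ i / (M i + 1))
  have hδ : ∀ i, 0 < δ i := fun i => lt_min hε (by have := hM0 i; positivity)
  choose h hh hbd using fun i => hloc (c i) (δ i) (hδ i)
  have hg := hasMFDerivAt_partition_finsum hf (fun i => hU (c i)) hh
  refine ⟨fun x => ∑ᶠ i, f i x • h i x, hf.contMDiff_finsum_smul (fun i => hU (c i)) hh,
    fun p => ⟨?_, ?_⟩⟩
  · have h1 : ∀ i ∈ f.finsupport p, |h i p - d p| ≤ ε := fun i hi =>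
      (hbd i p (hf i ((f.mem_fintsupport_iff p i).1
        (f.finsupport_subset_fintsupport p hi)))).1.trans (min_le_left _ _)
    have h2 := f.sum_finsupport p (mem_univ p)
    simp only
    rw [← f.sum_finsupport_smul_eq_finsum]
    calc |∑ i ∈ f.finsupport p, f i p • h i p - d p|
        = |∑ i ∈ f.finsupport p, f i p * (h i p - d p)| := by
          simp only [mul_sub, Finset.sum_sub_distrib, ← Finset.sum_mul, h2, one_mul, smul_eq_mul]
      _ ≤ ∑ i ∈ f.finsupport p, f i p * ε := by
          refine (Finset.abs_sum_le_sum_abs _ _).trans (Finset.sum_le_sum fun i hi => ?_)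
          rw [abs_mul, abs_of_nonneg (f.nonneg i p)]
          exact mul_le_mul_of_nonneg_left (h1 i hi) (f.nonneg i p)
      _ = ε := by rw [← Finset.sum_mul, h2, one_mul]
  · have hmemU : ∀ i ∈ f.fintsupport p, p ∈ U (c i) := fun i hi =>
      hf i ((f.mem_fintsupport_iff p i).1 hi)
    have h2 := f.sum_finsupport' p (mem_univ p) (f.finsupport_subset_fintsupport p)
    have h3 : (∑ i ∈ f.fintsupport p, (f i p • differential (n := n) (h i) p
        + h i p • differential (n := n) (f i) p))
        = ∑ i ∈ f.fintsupport p, (f i p • differential (n := n) (h i) p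
          + (h i p - d p) • differential (n := n) (f i) p) := by
      simp only [sub_smul, Finset.sum_add_distrib, Finset.sum_sub_distrib, ← Finset.smul_sum,
        sum_differential_partition, smul_zero, sub_zero]
    refine (gradNorm_eq_of_hasMFDerivAt (hg p)).trans_le
      ((congrArg (fun L => ‖covector (n := n) p L‖) h3).trans_le ?_)
    rw [map_sum]
    calc _ ≤ ∑ i ∈ f.fintsupport p, (f i p * 4 + 1 / 2 / 2 ^ i) := by
          refine norm_sum_le_of_le _ fun i hi => ?_
          obtain ⟨h4, h5⟩ := hbd i p (hmemU i hi)
          rw [map_add, map_smul, map_smul]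
          refine norm_add_le_of_le ?_ ?_
          · rw [norm_smul, Real.norm_of_nonneg (f.nonneg i p), ← gradNorm_eq_differential]
            exact mul_le_mul_of_nonneg_left h5 (f.nonneg i p)
          · rw [norm_smul, ← gradNorm_eq_differential, Real.norm_eq_abs]
            have h6 := hM0 i
            calc |h i p - d p| * gradNorm n (f i) p
                ≤ (1 / 2 / 2 ^ i / (M i + 1)) * (M i + 1) := by
                  refine mul_le_mul (h4.trans (min_le_right _ _)) ((hM i p).trans (by linarith))
                    (gradNorm_nonneg _ _) (by positivity)
              _ = 1 / 2 / 2 ^ i := by field_simp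
      _ ≤ 5 := by
          rw [Finset.sum_add_distrib, ← Finset.sum_mul, h2]
          linarith [sum_half_pow_le (f.fintsupport p) zero_le_one]

end Partition

/-! ### Cutoff functions on balls and the small positive weight -/

theorem exists_cutoff_real : ∃ χ : ℝ → ℝ, ∃ C : ℝ, ContDiff ℝ ∞ χ ∧
    (∀ t, 0 ≤ χ t ∧ χ t ≤ 1 ∧ |deriv χ t| ≤ C) ∧ (∀ t, |t| ≤ 9 / 16 → χ t = 1) ∧
    ∀ t, 15 / 16 ≤ t → χ t = 0 ∧ deriv χ t = 0 := by
  let b : ContDiffBump (0 : ℝ) := ⟨5 / 8, 7 / 8, by norm_num, by norm_num⟩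
  have hb : ContDiff ℝ ∞ b := b.contDiff
  obtain ⟨C, hC⟩ := b.hasCompactSupport.deriv.exists_bound_of_continuous
    (hb.continuous_deriv (by simp))
  refine ⟨b, C, hb, fun t => ⟨b.nonneg, b.le_one, hC t⟩, fun t ht => ?_, fun t ht => ?_⟩
  · refine b.one_of_mem_closedBall ?_
    rw [mem_closedBall_zero_iff, Real.norm_eq_abs]
    exact ht.trans (by norm_num [b])
  · have h1 : t ∉ tsupport b := by
      rw [b.tsupport_eq, mem_closedBall_zero_iff, Real.norm_eq_abs, not_le]
      exact lt_of_lt_of_le (by norm_num [b]) (ht.trans (le_abs_self t))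
    have h2 := notMem_tsupport_iff_eventuallyEq.1 h1
    exact ⟨h2.eq_of_nhds, by rw [h2.deriv_eq]; simp⟩

section Cutoff

variable {n : ℕ} {X : Type*} [MetricSpace X] [ChartedSpace (EuclideanSpace ℝ (Fin (n + 1))) X]
  [IsManifold (𝓡 (n + 1)) ∞ X] [RiemannianBundle (fun x : X => TangentSpace (𝓡 (n + 1)) x)]
  [IsContMDiffRiemannianBundle (𝓡 (n + 1)) ∞ (EuclideanSpace ℝ (Fin (n + 1)))
      (fun x : X => TangentSpace (𝓡 (n + 1)) x)]

local notation "𝔼" => EuclideanSpace ℝ (Fin (n + 1))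
local notation "𝕀" => 𝓡 (n + 1)

theorem gradNorm_comp_real {g : X → ℝ} (hg : ContMDiff 𝕀 𝓘(ℝ, ℝ) ∞ g) {φ : ℝ → ℝ} {φ' : ℝ} {p : X}
    (hφ : HasDerivAt φ φ' (g p)) : gradNorm n (fun x => φ (g x)) p = |φ'| * gradNorm n g p := by
  obtain ⟨L, hL⟩ := hasMFDerivAt_real hg p
  rw [gradNorm_eq_of_hasMFDerivAt (HasMFDerivAt.comp_real hL hφ), gradNorm_eq_of_hasMFDerivAt hL,
    map_smul, norm_smul, Real.norm_eq_abs]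

/-- Smooth cutoff functions adapted to concentric metric balls, with scale-invariant gradient
bound. -/
theorem exists_cutoff (n : ℕ) : ∃ C : ℝ, ∀ {X : Type*} [MetricSpace X] [SecondCountableTopology X]
    [ChartedSpace (EuclideanSpace ℝ (Fin (n + 1))) X] [IsManifold (𝓡 (n + 1)) ∞ X]
    [RiemannianBundle (fun x : X => TangentSpace (𝓡 (n + 1)) x)]
    [IsContMDiffRiemannianBundle (𝓡 (n + 1)) ∞ (EuclideanSpace ℝ (Fin (n + 1)))
      (fun x : X => TangentSpace (𝓡 (n + 1)) x)] [IsRiemannianManifold (𝓡 (n + 1)) X]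
    (x : X) {r : ℝ}, 0 < r → ∃ η : X → ℝ, ContMDiff (𝓡 (n + 1)) 𝓘(ℝ, ℝ) ∞ η ∧
      (∀ p, 0 ≤ η p ∧ η p ≤ 1 ∧ r * gradNorm n η p ≤ C) ∧
      (∀ p ∈ Metric.ball x (r / 2), η p = 1) ∧
      ∀ p ∉ Metric.ball x r, η p = 0 ∧ gradNorm n η p = 0 := by
  obtain ⟨χ, C, hχ, hbd, hone, hzero⟩ := exists_cutoff_real
  refine ⟨C * 5, fun {X} _ _ _ _ _ _ _ x r hr => ?_⟩
  -- With error `r / 16`, the half ball has `g / r ≤ 9/16` and the complement of the ball has `g / r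
  -- ≥ 15/16`, the two thresholds of `χ`.
  obtain ⟨g, hg, hgd⟩ := exists_smoothing (n := n) (LipschitzWith.dist_left x)
    (ε := r / 16) (by positivity)
  have hderiv : ∀ p, HasDerivAt (fun t => χ (r⁻¹ * t)) (deriv χ (r⁻¹ * g p) * r⁻¹) (g p) := by
    intro p
    have h1 : HasDerivAt (fun t => r⁻¹ * t) r⁻¹ (g p) := by
      simpa using (hasDerivAt_id (g p)).const_mul r⁻¹
    exact ((hχ.differentiable (by simp)).differentiableAt.hasDerivAt).comp (g p) h1
  have hgrad := fun p => gradNorm_comp_real hg (hderiv p)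
  refine ⟨fun p => χ (r⁻¹ * g p), ?_, fun p => ⟨(hbd _).1, (hbd _).2.1, ?_⟩, fun p hp => ?_,
    fun p hp => ?_⟩
  · exact (hχ.comp (contDiff_const.mul contDiff_id)).contMDiff.comp hg
  · rw [hgrad, abs_mul, abs_of_pos (inv_pos.2 hr)]
    calc r * (|deriv χ (r⁻¹ * g p)| * r⁻¹ * gradNorm n g p)
        = |deriv χ (r⁻¹ * g p)| * gradNorm n g p := by field_simp
      _ ≤ C * 5 := mul_le_mul (hbd _).2.2 (hgd p).2 (gradNorm_nonneg _ _)
          ((abs_nonneg _).trans (hbd 0).2.2)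
  · refine hone _ ?_
    have h1 := abs_le.1 (hgd p).1
    have h2 := Metric.mem_ball.1 hp
    have h3 : (0 : ℝ) ≤ dist p x := dist_nonneg
    rw [abs_mul, abs_of_pos (inv_pos.2 hr), inv_mul_le_iff₀ hr, abs_le]
    constructor <;> linarith
  · have h1 := abs_le.1 (hgd p).1
    have h2 := not_lt.1 (fun h => hp (Metric.mem_ball.2 h))
    have h3 : 15 / 16 ≤ r⁻¹ * g p := by
      rw [le_inv_mul_iff₀ hr]
      linarith
    obtain ⟨h4, h5⟩ := hzero _ h3
    exact ⟨h4, by rw [hgrad, h5]; simp⟩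

/-- A positive smooth weight with small integral against a given locally finite measure. -/
theorem exists_weight [SecondCountableTopology X] [MeasurableSpace X] [BorelSpace X] [Nonempty X]
    (Θ : Measure X) [IsLocallyFiniteMeasure Θ] {κ : ℝ} (hκ : 0 < κ) :
    ∃ w : X → ℝ, ContMDiff 𝕀 𝓘(ℝ, ℝ) ∞ w ∧ (∀ p, 0 < w p ∧ w p ≤ 1 ∧ gradNorm n w p ≤ 1) ∧
      ∫⁻ p, ENNReal.ofReal (w p + gradNorm n w p) ∂Θ ≤ ENNReal.ofReal κ := by
  have : LocallyCompactSpace X := ChartedSpace.locallyCompactSpace 𝔼 X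
  choose K hK hKq using fun q : X => exists_compact_mem_nhds q
  obtain ⟨c, f, hf⟩ := exists_partition (n := n) (U := fun q => interior (K q))
    (fun q => isOpen_interior) (fun q => mem_interior_iff_mem_nhds.2 (hKq q))
  have hcs : ∀ i, HasCompactSupport (f i) := fun i =>
    (hK (c i)).of_isClosed_subset (isClosed_tsupport _) ((hf i).trans interior_subset)
  choose M hM0 hM using fun i => exists_gradNorm_le (n := n) (f i).contMDiff (hcs i)
  let T : ℕ → ℝ := fun i => (Θ (tsupport (f i))).toReal
  have hT0 : ∀ i, 0 ≤ T i := fun i => ENNReal.toReal_nonneg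
  let κ' := min 1 κ
  have hκ' : 0 < κ' := lt_min one_pos hκ
  -- The factor `1 + M i` controls value and gradient pointwise, and `1 + T i` the measure of the
  -- support. Both resulting series are dominated by a geometric one with sum `κ' ≤ min 1 κ`.
  let a : ℕ → ℝ := fun i => κ' / 2 / 2 ^ i / ((1 + M i) * (1 + T i))
  have ha : ∀ i, 0 < a i := fun i => by have := hM0 i; have := hT0 i; positivity
  have haM : ∀ i, a i * ((1 + M i) * (1 + T i)) = κ' / 2 / 2 ^ i := fun i => by
    have := hM0 i; have := hT0 i
    exact div_mul_cancel₀ _ (by positivity)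
  have haM1 : ∀ i, a i * (1 + M i) ≤ κ' / 2 / 2 ^ i := fun i => by
    rw [← haM i, ← mul_assoc]
    have := ha i; have := hM0 i
    exact le_mul_of_one_le_right (by positivity) (by linarith [hT0 i])
  have hconst : ∀ i, ContMDiffOn 𝕀 𝓘(ℝ, ℝ) ∞ (fun _ : X => a i) (interior (K (c i))) :=
    fun i => contMDiffOn_const
  set w : X → ℝ := fun x => ∑ᶠ i, f i x • a i with hw
  have hsmooth : ContMDiff 𝕀 𝓘(ℝ, ℝ) ∞ w :=
    hf.contMDiff_finsum_smul (fun i => isOpen_interior) hconst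
  have hwsum : ∀ p, w p = ∑ i ∈ f.fintsupport p, f i p * a i := by
    intro p
    have h1 : w p = ∑ i ∈ f.finsupport p, f i p * a i :=
      (f.sum_finsupport_smul_eq_finsum p (fun i _ => a i)).symm
    rw [h1]
    refine Finset.sum_subset (f.finsupport_subset_fintsupport p) fun i _ hi => ?_
    rw [f.mem_finsupport, Function.notMem_support] at hi
    rw [hi, zero_mul]
  have hgrad : ∀ p, gradNorm n w p ≤ ∑ i ∈ f.fintsupport p, a i * gradNorm n (f i) p := by
    intro p
    refine (gradNorm_eq_of_hasMFDerivAt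
      (hasMFDerivAt_partition_finsum hf (fun i => isOpen_interior) hconst p)).trans_le ?_
    refine (congrArg (fun L => ‖covector (n := n) p L‖) (Finset.sum_congr rfl fun i _ => ?_)
      : _ = ‖covector (n := n) p
        (∑ i ∈ f.fintsupport p, a i • differential (n := n) (f i) p)‖).trans_le ?_
    · have : differential (n := n) (fun _ : X => a i) p = 0 :=
        (hasMFDerivAt_const (a i) p).mfderiv
      rw [this, smul_zero, zero_add]
    · rw [map_sum]
      refine norm_sum_le_of_le _ fun i _ => ?_
      rw [map_smul, norm_smul, Real.norm_of_nonneg (ha i).le, ← gradNorm_eq_differential]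
  have hterm : ∀ i p, f i p * a i + a i * gradNorm n (f i) p ≤ a i * (1 + M i) := by
    intro i p
    have h1 := f.le_one i p
    nlinarith [hM i p, ha i, mul_le_mul_of_nonneg_left (hM i p) (ha i).le]
  have hle : ∀ p, w p + gradNorm n w p ≤ ∑ i ∈ f.fintsupport p, a i * (1 + M i) := by
    intro p
    calc w p + gradNorm n w p
        ≤ ∑ i ∈ f.fintsupport p, (f i p * a i + a i * gradNorm n (f i) p) := by
          rw [Finset.sum_add_distrib, hwsum]
          exact add_le_add le_rfl (hgrad p)
      _ ≤ _ := Finset.sum_le_sum fun i _ => hterm i p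
  have hpos : ∀ p, 0 < w p := by
    intro p
    obtain ⟨i, hi⟩ := f.exists_pos_of_mem (mem_univ p)
    rw [hwsum]
    refine Finset.sum_pos' (fun j _ => mul_nonneg (f.nonneg j p) (ha j).le)
      ⟨i, f.finsupport_subset_fintsupport p ((f.mem_finsupport p).2 hi.ne'), mul_pos hi (ha i)⟩
  have hle1 : ∀ p, w p + gradNorm n w p ≤ 1 := fun p =>
    (hle p).trans ((Finset.sum_le_sum fun i _ => haM1 i).trans
      ((sum_half_pow_le _ hκ'.le).trans (min_le_left _ _)))
  refine ⟨w, hsmooth, fun p => ⟨hpos p, by linarith [hle1 p, gradNorm_nonneg (n := n) w p],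
    by linarith [hle1 p, hpos p]⟩, ?_⟩
  calc ∫⁻ p, ENNReal.ofReal (w p + gradNorm n w p) ∂Θ
      ≤ ∫⁻ p, ∑' i, (tsupport (f i)).indicator (fun _ => ENNReal.ofReal (a i * (1 + M i))) p ∂Θ := by
        refine lintegral_mono fun p => ?_
        refine (ENNReal.ofReal_le_ofReal (hle p)).trans ?_
        rw [ENNReal.ofReal_sum_of_nonneg fun i _ => by have := ha i; have := hM0 i; positivity]
        refine le_trans (Finset.sum_le_sum fun i hi => ?_) (ENNReal.sum_le_tsum (f.fintsupport p))
        rw [indicator_of_mem ((f.mem_fintsupport_iff p i).1 hi)]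
    _ = ∑' i, ENNReal.ofReal (a i * (1 + M i)) * Θ (tsupport (f i)) := by
        rw [lintegral_tsum fun i =>
          (measurable_const.indicator (isClosed_tsupport _).measurableSet).aemeasurable]
        simp only [lintegral_indicator_const (isClosed_tsupport _).measurableSet]
    _ ≤ ∑' i, ENNReal.ofReal (κ' / 2 / 2 ^ i) := by
        refine ENNReal.tsum_le_tsum fun i => ?_
        rw [← ENNReal.ofReal_toReal (hcs i).isCompact.measure_lt_top.ne,
          ← ENNReal.ofReal_mul (by have := ha i; have := hM0 i; positivity), ← haM i, ← mul_assoc]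
        have := ha i; have := hM0 i
        exact ENNReal.ofReal_le_ofReal
          (mul_le_mul_of_nonneg_left (by simp only [T]; linarith) (by positivity))
    _ = ENNReal.ofReal κ' := by
        rw [← ENNReal.ofReal_tsum_of_nonneg (fun i => by positivity) (summable_geometric_two' κ'),
          tsum_geometric_two']
    _ ≤ ENNReal.ofReal κ := ENNReal.ofReal_le_ofReal (min_le_right _ _)

end Cutoff

/-! ### Estimates for the density `η² + w²` -/

theorem integrable_and_integral_le {α : Type*} [MeasurableSpace α] {μ : Measure α} {f : α → ℝ}
    (hf : AEStronglyMeasurable f μ) (h0 : ∀ x, 0 ≤ f x) {κ : ℝ} (hκ : 0 ≤ κ)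
    (h : ∫⁻ x, ENNReal.ofReal (f x) ∂μ ≤ ENNReal.ofReal κ) : Integrable f μ ∧ ∫ x, f x ∂μ ≤ κ := by
  refine ⟨⟨hf, (hasFiniteIntegral_iff_ofReal (Eventually.of_forall h0)).2
    (h.trans_lt ENNReal.ofReal_lt_top)⟩, ?_⟩
  rw [integral_eq_lintegral_of_nonneg_ae (Eventually.of_forall h0) hf]
  exact ENNReal.toReal_le_of_le_ofReal hκ h

theorem isLocallyFiniteMeasure_add {α : Type*} [TopologicalSpace α] [MeasurableSpace α]
    (μ ν : Measure α) [IsLocallyFiniteMeasure μ] [IsLocallyFiniteMeasure ν] :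
    IsLocallyFiniteMeasure (μ + ν) := by
  refine ⟨fun x => ?_⟩
  obtain ⟨s, hs, hμ⟩ := μ.finiteAt_nhds x
  obtain ⟨t, ht, hν⟩ := ν.finiteAt_nhds x
  refine ⟨s ∩ t, inter_mem hs ht, ?_⟩
  rw [Measure.add_apply]
  exact ENNReal.add_lt_top.2 ⟨(measure_mono inter_subset_left).trans_lt hμ,
    (measure_mono inter_subset_right).trans_lt hν⟩

/-- With `s = a² + b²`, the inequality `log √s ≥ 1 - 1/√s` gives `s log s ≥ -2√s`, and `√s ≤ a + b`.
A bound linear in `b` is needed because the weight is only known to be integrable to first order. -/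
theorem abs_mul_log_le {a b : ℝ} (ha : 0 ≤ a) (ha1 : a ≤ 1) (hb : 0 < b) (hb1 : b ≤ 1) :
    |(a ^ 2 + b ^ 2) * Real.log (a ^ 2 + b ^ 2)| ≤ 4 * (a + b) := by
  set s := a ^ 2 + b ^ 2 with hs
  have hs0 : 0 < s := by positivity
  have hsab : s ≤ a + b := by nlinarith
  have hsq : √s ≤ a + b := by
    rw [Real.sqrt_le_left (by positivity)]
    nlinarith
  have hq0 : 0 < √s := Real.sqrt_pos.2 hs0
  rw [abs_le]
  constructor
  · have h1 := Real.one_sub_inv_le_log_of_pos hq0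
    have h2 : Real.log s = 2 * Real.log √s := by
      rw [Real.log_sqrt hs0.le]
      ring
    have h3 : -(2 * √s) ≤ s * Real.log s := by
      rw [h2]
      calc -(2 * √s) ≤ 2 * (s - √s) := by linarith
        _ = s * (2 * (1 - (√s)⁻¹)) := by
          have : √s * √s = s := Real.mul_self_sqrt hs0.le
          field_simp
          nlinarith
        _ ≤ _ := by gcongr
    linarith
  · have h1 := Real.log_le_sub_one_of_pos hs0
    have h2 : s * Real.log s ≤ s * (s - 1) := by gcongr
    nlinarith

section Weight

variable {n : ℕ} {X : Type*} [MetricSpace X] [ChartedSpace (EuclideanSpace ℝ (Fin (n + 1))) X]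
  [IsManifold (𝓡 (n + 1)) ∞ X] [RiemannianBundle (fun x : X => TangentSpace (𝓡 (n + 1)) x)]
  [IsContMDiffRiemannianBundle (𝓡 (n + 1)) ∞ (EuclideanSpace ℝ (Fin (n + 1)))
      (fun x : X => TangentSpace (𝓡 (n + 1)) x)]

local notation "𝔼" => EuclideanSpace ℝ (Fin (n + 1))
local notation "𝕀" => 𝓡 (n + 1)

/-- Cauchy–Schwarz for `∇s = 2η∇η + 2w∇w`. Dividing by `s` bounds `|∇ log s|² s` with no loss where
`s` is small. -/
theorem gradNorm_sq_add_sq_le {η w : X → ℝ} (hη : ContMDiff 𝕀 𝓘(ℝ, ℝ) ∞ η)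
    (hw : ContMDiff 𝕀 𝓘(ℝ, ℝ) ∞ w) (p : X) :
    gradNorm n (fun x => η x ^ 2 + w x ^ 2) p ^ 2
      ≤ 4 * (η p ^ 2 + w p ^ 2) * (gradNorm n η p ^ 2 + gradNorm n w p ^ 2) := by
  obtain ⟨L, hL⟩ := hasMFDerivAt_real hη p
  obtain ⟨M, hM⟩ := hasMFDerivAt_real hw p
  have h1 := HasMFDerivAt.comp_real hL (hasDerivAt_pow 2 (η p))
  have h2 := HasMFDerivAt.comp_real hM (hasDerivAt_pow 2 (w p))
  have h3 : gradNorm n (fun x => η x ^ 2 + w x ^ 2) p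
      ≤ 2 * |η p| * gradNorm n η p + 2 * |w p| * gradNorm n w p := by
    refine (gradNorm_eq_of_hasMFDerivAt (h1.add h2)).trans_le ?_
    refine (congrArg norm (map_add (covector (n := n) p) _ _)).trans_le ?_
    refine norm_add_le_of_le ?_ ?_
    · rw [map_smul, norm_smul, gradNorm_eq_of_hasMFDerivAt hL]
      simp
    · rw [map_smul, norm_smul, gradNorm_eq_of_hasMFDerivAt hM]
      simp
  have h4 := gradNorm_nonneg (n := n) (fun x => η x ^ 2 + w x ^ 2) p
  rw [← sq_abs (η p), ← sq_abs (w p)]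
  calc _ ≤ (2 * |η p| * gradNorm n η p + 2 * |w p| * gradNorm n w p) ^ 2 := by gcongr
    _ ≤ _ := by nlinarith [sq_nonneg (|η p| * gradNorm n w p - |w p| * gradNorm n η p)]

/-- A single weight serves all three integrals: `exists_weight` is applied to the measure `(1 + |P|)
μ + |β| σ`, locally finite by continuity of `P` and `β`. -/
theorem exists_integrable_weight [SecondCountableTopology X] [MeasurableSpace X] [BorelSpace X]
    [Nonempty X] (μ σ : Measure X) [IsLocallyFiniteMeasure μ] [IsLocallyFiniteMeasure σ]
    {P β : X → ℝ} (hP : Continuous P) (hβ : Continuous β) {κ : ℝ} (hκ : 0 < κ) :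
    ∃ w : X → ℝ, ContMDiff 𝕀 𝓘(ℝ, ℝ) ∞ w ∧ (∀ p, 0 < w p ∧ w p ≤ 1 ∧ gradNorm n w p ≤ 1) ∧
      (Integrable (fun p => w p + gradNorm n w p) μ ∧ ∫ p, w p + gradNorm n w p ∂μ ≤ κ) ∧
      (Integrable (fun p => |P p| * (w p + gradNorm n w p)) μ ∧
        ∫ p, |P p| * (w p + gradNorm n w p) ∂μ ≤ κ) ∧
      (Integrable (fun p => |β p| * (w p + gradNorm n w p)) σ ∧
        ∫ p, |β p| * (w p + gradNorm n w p) ∂σ ≤ κ) := by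
  have hP1 : Continuous fun p => 1 + |P p| := continuous_const.add hP.abs
  have h1 : IsLocallyFiniteMeasure (μ.withDensity fun p => .ofReal (1 + |P p|)) :=
    IsLocallyFiniteMeasure.withDensity_ofReal hP1
  have h2 : IsLocallyFiniteMeasure (σ.withDensity fun p => .ofReal |β p|) :=
    IsLocallyFiniteMeasure.withDensity_ofReal hβ.abs
  have := isLocallyFiniteMeasure_add (μ.withDensity fun p => .ofReal (1 + |P p|))
    (σ.withDensity fun p => .ofReal |β p|)
  obtain ⟨w, hw, hw1, hint⟩ := exists_weight (n := n) (μ.withDensity (fun p => .ofReal (1 + |P p|))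
    + σ.withDensity fun p => .ofReal |β p|) hκ
  have hcont : Continuous fun p => w p + gradNorm n w p :=
    hw.continuous.add (continuous_gradNorm hw)
  have hm0 : ∀ p, 0 ≤ w p + gradNorm n w p := fun p =>
    add_nonneg (hw1 p).1.le (gradNorm_nonneg _ _)
  have hmeas := hcont.measurable.ennreal_ofReal
  rw [lintegral_add_measure,
    lintegral_withDensity_eq_lintegral_mul _ hP1.measurable.ennreal_ofReal hmeas,
    lintegral_withDensity_eq_lintegral_mul _ hβ.abs.measurable.ennreal_ofReal hmeas] at hint
  have hμ := le_self_add.trans hint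
  have hσ := le_add_self.trans hint
  refine ⟨w, hw, hw1, ?_, ?_, ?_⟩
  · refine integrable_and_integral_le hcont.aestronglyMeasurable hm0 hκ.le
      ((lintegral_mono fun p => ?_).trans hμ)
    change _ ≤ ENNReal.ofReal (1 + |P p|) * ENNReal.ofReal (w p + gradNorm n w p)
    rw [← ENNReal.ofReal_mul (by positivity)]
    exact ENNReal.ofReal_le_ofReal (le_mul_of_one_le_left (hm0 p) (by simp))
  · refine integrable_and_integral_le (hP.abs.mul hcont).aestronglyMeasurable
      (fun p => mul_nonneg (abs_nonneg _) (hm0 p)) hκ.le ((lintegral_mono fun p => ?_).trans hμ)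
    change _ ≤ ENNReal.ofReal (1 + |P p|) * ENNReal.ofReal (w p + gradNorm n w p)
    rw [← ENNReal.ofReal_mul (by positivity)]
    exact ENNReal.ofReal_le_ofReal (mul_le_mul_of_nonneg_right (by simp) (hm0 p))
  · refine integrable_and_integral_le (hβ.abs.mul hcont).aestronglyMeasurable
      (fun p => mul_nonneg (abs_nonneg _) (hm0 p)) hκ.le ((lintegral_mono fun p => ?_).trans hσ)
    change _ ≤ ENNReal.ofReal |β p| * ENNReal.ofReal (w p + gradNorm n w p)
    rw [← ENNReal.ofReal_mul (by positivity)]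
    exact le_rfl

end Weight

/-! ### The test function concentrated in a ball and its entropy -/

section Collapse

variable {n : ℕ} {X : Type*} [MetricSpace X] [MeasurableSpace X] [BorelSpace X]
  [ChartedSpace (EuclideanSpace ℝ (Fin (n + 1))) X]
  [IsManifold (𝓡 (n + 1)) ∞ X] [RiemannianBundle (fun x : X => TangentSpace (𝓡 (n + 1)) x)]
  [IsContMDiffRiemannianBundle (𝓡 (n + 1)) ∞ (EuclideanSpace ℝ (Fin (n + 1)))
      (fun x : X => TangentSpace (𝓡 (n + 1)) x)]

local notation "𝔼" => EuclideanSpace ℝ (Fin (n + 1))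
local notation "𝕀" => 𝓡 (n + 1)

/-- The density of the function `f` with `u = s / Z`. -/
theorem density_log_sub {s : X → ℝ} (hs : ∀ p, 0 < s p) {Z τ : ℝ} (hZ : 0 < Z) (hτ : 0 < τ)
    (p : X) :
    density n (fun x => (Real.log Z - ((n : ℝ) + 1) / 2 * Real.log (4 * Real.pi * τ))
      - Real.log (s x)) τ p = s p / Z := by
  have h0 : 0 < 4 * Real.pi * τ := by positivity
  rw [density, Real.rpow_def_of_pos h0, ← Real.exp_sub]
  rw [show -(Real.log Z - ((n : ℝ) + 1) / 2 * Real.log (4 * Real.pi * τ) - Real.log (s p))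
    - Real.log (4 * Real.pi * τ) * (((n : ℝ) + 1) / 2) = Real.log (s p) - Real.log Z by ring,
    Real.exp_sub, Real.exp_log (hs p), Real.exp_log hZ]

theorem gradNorm_const_sub_log {s : X → ℝ} (hs : ContMDiff 𝕀 𝓘(ℝ, ℝ) ∞ s) (hpos : ∀ p, 0 < s p)
    (L : ℝ) (p : X) : gradNorm n (fun x => L - Real.log (s x)) p = gradNorm n s p / s p := by
  rw [gradNorm_comp_real hs ((Real.hasDerivAt_log (hpos p).ne').const_sub L), abs_neg,
    abs_of_pos (inv_pos.2 (hpos p)), inv_mul_eq_div]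

/-- Since `(r ^ 2) ^ ((n + 1) / 2) = r ^ (n + 1)`, the normalising constant compares mass with the
Euclidean scale; the factor from `4π ≥ 1` has the favourable sign and is dropped. This term drives
the functional to `-∞`. -/
theorem log_sub_log_le (n : ℕ) {Z V r : ℝ} (hr : 0 < r) (hZ : 0 < Z) (hZV : Z ≤ 2 * V) :
    Real.log Z - ((n : ℝ) + 1) / 2 * Real.log (4 * Real.pi * r ^ 2)
      ≤ Real.log (2 * V / r ^ (n + 1)) := by
  rw [Real.log_div (by linarith) (by positivity), Real.log_mul (x := 4 * Real.pi)
    (by positivity) (by positivity), Real.log_pow, Real.log_pow]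
  have h1 : Real.log Z ≤ Real.log (2 * V) := Real.log_le_log hZ hZV
  have h2 : 0 ≤ Real.log (4 * Real.pi) := Real.log_nonneg (by nlinarith [Real.pi_gt_three])
  have h3 : 0 ≤ ((n : ℝ) + 1) / 2 * Real.log (4 * Real.pi) := mul_nonneg (by positivity) h2
  push_cast
  linarith

variable [SecondCountableTopology X] [IsRiemannianManifold (𝓡 (n + 1)) X]

set_option maxHeartbeats 1000000 in
/-- The entropy of the competitor concentrated in a ball. -/
theorem exists_isCompetitor_le {Ω : Set X} (hΩ : IsOpen Ω) (hb : HasSmoothBoundary n Ω)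
    {P β : X → ℝ} (hP : Continuous P) (hβ : Continuous β) {x : X} {r : ℝ} (hr : 0 < r)
    (hv : 0 < (μHE[n + 1] : Measure X) (Ω ∩ Metric.ball x (r / 2)))
    (hV : (μHE[n + 1] : Measure X) (Ω ∩ Metric.ball x r) < ⊤)
    (hbd : ∫⁻ y in frontier Ω ∩ Metric.ball x r, ENNReal.ofReal |β y| ∂(μHE[n] : Measure X) < ⊤)
    {c : ℝ} (hc : ∀ y ∈ Ω ∩ Metric.ball x r, r ^ 2 * |P y| ≤ c) {C : ℝ} {η : X → ℝ}
    (hη : ContMDiff 𝕀 𝓘(ℝ, ℝ) ∞ η)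
    (hη1 : ∀ p, 0 ≤ η p ∧ η p ≤ 1 ∧ r * gradNorm n η p ≤ C)
    (hηin : ∀ p ∈ Metric.ball x (r / 2), η p = 1)
    (hηout : ∀ p ∉ Metric.ball x r, η p = 0 ∧ gradNorm n η p = 0) :
    ∃ f : X → ℝ, IsCompetitor n P β Ω (r ^ 2) f ∧ entropyFunctional n P β Ω f (r ^ 2)
      ≤ Real.log (2 * ((μHE[n + 1] : Measure X) (Ω ∩ Metric.ball x r)).toReal / r ^ (n + 1))
        + ((4 * C ^ 2 + c + 4) * ((μHE[n + 1] : Measure X) (Ω ∩ Metric.ball x r)).toReal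
          + 2 * r ^ 2 * (∫⁻ y in frontier Ω ∩ Metric.ball x r, ENNReal.ofReal |β y|
              ∂(μHE[n] : Measure X)).toReal)
          / ((μHE[n + 1] : Measure X) (Ω ∩ Metric.ball x (r / 2))).toReal + 11 := by
  have hVle : Ω ∩ Metric.ball x (r / 2) ⊆ Ω ∩ Metric.ball x r :=
    inter_subset_inter_right _ (Metric.ball_subset_ball (by linarith))
  have hvlt := (measure_mono hVle).trans_lt hV
  obtain ⟨y₀, hy₀⟩ := nonempty_of_measure_ne_zero hv.ne'
  have : Nonempty X := ⟨y₀⟩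
  have hc0 : 0 ≤ c := le_trans (by positivity) (hc y₀ (hVle hy₀))
  set μ : Measure X := (μHE[n + 1] : Measure X).restrict Ω with hμ
  set σ : Measure X := (μHE[n] : Measure X).restrict (frontier Ω) with hσ
  set B := Metric.ball x r with hB
  have hBm : MeasurableSet B := Metric.isOpen_ball.measurableSet
  have hμB : μ B = (μHE[n + 1] : Measure X) (Ω ∩ B) := by
    rw [hμ, Measure.restrict_apply hBm, inter_comm]
  have hμB' : μ (Metric.ball x (r / 2))
      = (μHE[n + 1] : Measure X) (Ω ∩ Metric.ball x (r / 2)) := by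
    rw [hμ, Measure.restrict_apply Metric.isOpen_ball.measurableSet, inter_comm]
  have hσB : (μHE[n] : Measure X).restrict (frontier Ω ∩ B) = σ.restrict B := by
    rw [hσ, Measure.restrict_restrict hBm, inter_comm]
  rw [hσB] at hbd ⊢
  rw [← hμB] at hV ⊢
  rw [← hμB'] at hv hvlt ⊢
  have hvV' : (μ (Metric.ball x (r / 2))).toReal ≤ (μ B).toReal :=
    ENNReal.toReal_mono hV.ne (measure_mono (Metric.ball_subset_ball (by linarith)))
  have hv' := ENNReal.toReal_pos hv.ne' hvlt.ne
  set V := (μ B).toReal with hVdef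
  set v := (μ (Metric.ball x (r / 2))).toReal with hvdef
  set b := (∫⁻ y in B, ENNReal.ofReal |β y| ∂σ).toReal with hbdef
  have : IsLocallyFiniteMeasure (μHE[n + 1] : Measure X) := isLocallyFiniteMeasure_volume
  have : IsLocallyFiniteMeasure μ := Measure.isLocallyFiniteMeasure_of_le Measure.restrict_le_self
  have : IsLocallyFiniteMeasure σ := isLocallyFiniteMeasure_area hΩ hb
  -- Chosen so that both `κ` and `r ^ 2 * κ` are at most `v`: every contribution of the weight is
  -- then absorbed after division by `Z ≥ v`.
  set κ := v * min 1 (r ^ 2)⁻¹ with hκdef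
  have hr2 : 0 < r ^ 2 := by positivity
  have hκ : 0 < κ := mul_pos hv' (lt_min one_pos (by positivity))
  have hκv : κ ≤ v := mul_le_of_le_one_right hv'.le (min_le_left _ _)
  have hκr : r ^ 2 * κ ≤ v := by
    calc r ^ 2 * κ ≤ r ^ 2 * (v * (r ^ 2)⁻¹) := by
          rw [hκdef]; gcongr; exact min_le_right _ _
      _ = v := by field_simp
  obtain ⟨w, hw, hw1, ⟨hmi, hmκ⟩, ⟨hPi, hPκ⟩, ⟨hβi, hβκ⟩⟩ :=
    exists_integrable_weight (n := n) μ σ hP hβ hκ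
  set m : X → ℝ := fun p => w p + gradNorm n w p with hm
  have hwm : ∀ p, w p ≤ m p := fun p => le_add_of_nonneg_right (gradNorm_nonneg _ _)
  -- All terms of the functional are dominated by combinations of `J`, carrying the contribution of
  -- `η`, and `m`, carrying that of `w`.
  set J : X → ℝ := B.indicator 1 with hJ
  have hJin : ∀ p ∈ B, J p = 1 := fun p hp => by simp [hJ, hp]
  have hJout : ∀ p ∉ B, J p = 0 := fun p hp => by simp [hJ, hp]
  have hJ0 : ∀ p, 0 ≤ J p := fun p => indicator_nonneg (fun _ _ => zero_le_one) p
  have hJi : Integrable J μ :=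
    (integrable_indicator_iff hBm).2 (integrableOn_const (C := (1 : ℝ)) hV.ne)
  have hJV : ∫ p, J p ∂μ = V := integral_indicator_one hBm
  have hβJ : (fun p => |β p| * J p) = B.indicator fun p => |β p| := by
    ext p
    by_cases hp : p ∈ B
    · simp [hJin p hp, hp]
    · simp [hJout p hp, hp]
  have hβJi : Integrable (fun p => |β p| * J p) σ := by
    rw [hβJ, integrable_indicator_iff hBm]
    exact ⟨hβ.abs.aestronglyMeasurable, (hasFiniteIntegral_iff_ofReal
      (Eventually.of_forall fun _ => abs_nonneg _)).2 hbd⟩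
  have hβJb : ∫ p, |β p| * J p ∂σ = b := by
    rw [hβJ, integral_indicator hBm, integral_eq_lintegral_of_nonneg_ae
      (Eventually.of_forall fun _ => abs_nonneg _) hβ.abs.aestronglyMeasurable]
  have hηJ : ∀ p, η p ≤ J p := by
    intro p
    by_cases hp : p ∈ B
    · rw [hJin p hp]; exact (hη1 p).2.1
    · rw [hJout p hp, (hηout p hp).1]
  have hηgrad : ∀ p, r ^ 2 * gradNorm n η p ^ 2 ≤ C ^ 2 * J p := by
    intro p
    by_cases hp : p ∈ B
    · rw [hJin p hp, ← mul_pow, mul_one]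
      have := mul_nonneg hr.le (gradNorm_nonneg (n := n) η p)
      have := (hη1 p).2.2
      gcongr
    · rw [hJout p hp, (hηout p hp).2]
      simp
  set s : X → ℝ := fun p => η p ^ 2 + w p ^ 2 with hs
  have hssm : ContMDiff 𝕀 𝓘(ℝ, ℝ) ∞ s := (hη.pow 2).add (hw.pow 2)
  have hspos : ∀ p, 0 < s p := fun p => by have := (hw1 p).1; positivity
  have hsle : ∀ p, s p ≤ η p + w p := fun p => by
    have := hη1 p; have := hw1 p
    simp only [hs]
    nlinarith
  have hsJm : ∀ p, s p ≤ J p + m p := fun p => (hsle p).trans (add_le_add (hηJ p) (hwm p))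
  have hJm : Integrable (fun p => J p + m p) μ := hJi.add hmi
  have hsi : Integrable s μ := by
    refine hJm.mono' hssm.continuous.aestronglyMeasurable (Eventually.of_forall fun p => ?_)
    rw [Real.norm_of_nonneg (hspos p).le]
    exact hsJm p
  set Z := ∫ p, s p ∂μ with hZdef
  have hvZ : v ≤ Z := by
    have hBm' : MeasurableSet (Metric.ball x (r / 2)) := Metric.isOpen_ball.measurableSet
    have h1 : v = ∫ p, (Metric.ball x (r / 2)).indicator (1 : X → ℝ) p ∂μ :=
      (integral_indicator_one hBm').symm
    rw [h1]
    refine integral_mono ((integrable_indicator_iff hBm').2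
      (integrableOn_const (C := (1 : ℝ)) hvlt.ne)) hsi fun p => ?_
    by_cases hp : p ∈ Metric.ball x (r / 2)
    · rw [indicator_of_mem hp]
      simp only [hs, hηin p hp, Pi.one_apply]
      nlinarith [sq_nonneg (w p)]
    · rw [indicator_of_notMem hp]
      exact (hspos p).le
  have hZV : Z ≤ V + κ := by
    calc Z ≤ ∫ p, J p + m p ∂μ := integral_mono hsi hJm hsJm
      _ ≤ V + κ := by
        rw [integral_add hJi hmi, hJV]
        exact add_le_add le_rfl hmκ
  have hZ : 0 < Z := hv'.trans_le hvZ
  set L : ℝ := Real.log Z - ((n : ℝ) + 1) / 2 * Real.log (4 * Real.pi * r ^ 2) with hL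
  set f : X → ℝ := fun p => L - Real.log (s p) with hf
  have hu : ∀ p, density n f (r ^ 2) p = s p / Z := density_log_sub hspos hZ hr2
  have hu' : density n f (r ^ 2) = fun p => s p / Z := funext hu
  have hfsm : ContMDiff 𝕀 𝓘(ℝ, ℝ) ∞ f := fun p =>
    contMDiffAt_const.sub
      (((Real.contDiffAt_log.2 (hspos p).ne').contMDiffAt).comp p (hssm p))
  have hgf : ∀ p, gradNorm n f p ^ 2 * s p ≤ 4 * (gradNorm n η p ^ 2 + gradNorm n w p ^ 2) := by
    intro p
    rw [gradNorm_const_sub_log hssm hspos L p]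
    have h1 := gradNorm_sq_add_sq_le hη hw p
    have h2 := hspos p
    rw [div_pow, div_mul_eq_mul_div, div_le_iff₀ (by positivity)]
    calc gradNorm n s p ^ 2 * s p
        ≤ (4 * s p * (gradNorm n η p ^ 2 + gradNorm n w p ^ 2)) * s p := by gcongr
      _ = _ := by ring
  have hgw : ∀ p, gradNorm n w p ^ 2 ≤ m p := fun p => by
    have := (hw1 p).2.2
    have := (hw1 p).1
    have h3 := gradNorm_nonneg (n := n) w p
    simp only [hm]
    nlinarith
  have hgs : ∀ p, r ^ 2 * (gradNorm n f p ^ 2 * s p) ≤ 4 * C ^ 2 * J p + 4 * r ^ 2 * m p := by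
    intro p
    have h1 := mul_le_mul_of_nonneg_left (hgf p) hr2.le
    have h2 := mul_le_mul_of_nonneg_left (hgw p) hr2.le
    linarith [hηgrad p]
  have hslog : ∀ p, |s p * Real.log (s p)| ≤ 4 * (J p + m p) := fun p =>
    (abs_mul_log_le (hη1 p).1 (hη1 p).2.1 (hw1 p).1 (hw1 p).2.1).trans
      (by linarith [hηJ p, hwm p])
  have hPs : ∀ᵐ p ∂μ, r ^ 2 * (|P p| * s p) ≤ c * J p + r ^ 2 * (|P p| * m p) := by
    filter_upwards [ae_restrict_mem hΩ.measurableSet] with p hp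
    have h1 := mul_le_mul_of_nonneg_left (hsJm p) (mul_nonneg hr2.le (abs_nonneg (P p)))
    have h2 : r ^ 2 * |P p| * J p ≤ c * J p := by
      by_cases hpB : p ∈ B
      · exact mul_le_mul_of_nonneg_right (hc p ⟨hp, hpB⟩) (hJ0 p)
      · simp [hJout p hpB]
    linarith
  have hscont : Continuous s := hssm.continuous
  have hgcont : Continuous (gradNorm n f) := continuous_gradNorm hfsm
  have hDi : Integrable (fun p => gradNorm n f p ^ 2 * s p) μ := by
    refine (((hJi.const_mul (4 * C ^ 2)).add (hmi.const_mul (4 * r ^ 2))).const_mul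
      (r ^ 2)⁻¹).mono' ((hgcont.pow 2).mul hscont).aestronglyMeasurable
      (Eventually.of_forall fun p => ?_)
    rw [Real.norm_of_nonneg (mul_nonneg (sq_nonneg _) (hspos p).le), le_inv_mul_iff₀ hr2]
    exact hgs p
  have hPsi : Integrable (fun p => P p * s p) μ := by
    refine (((hJi.const_mul c).add (hPi.const_mul (r ^ 2))).const_mul
      (r ^ 2)⁻¹).mono' (hP.mul hscont).aestronglyMeasurable ?_
    filter_upwards [hPs] with p hp
    rw [norm_mul, Real.norm_of_nonneg (hspos p).le, le_inv_mul_iff₀ hr2]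
    exact hp
  have hlogi : Integrable (fun p => s p * Real.log (s p)) μ := by
    refine (hJm.const_mul 4).mono' ?_ (Eventually.of_forall hslog)
    exact (hscont.mul (hscont.log fun p => (hspos p).ne')).aestronglyMeasurable
  have hfsi : Integrable (fun p => f p * s p) μ := by
    refine ((hsi.const_mul L).sub hlogi).congr (Eventually.of_forall fun p => ?_)
    simp only [hf, Pi.sub_apply]
    ring
  have hβs : ∀ p, |β p * s p| ≤ |β p| * J p + |β p| * m p := by
    intro p
    rw [abs_mul, abs_of_pos (hspos p), ← mul_add]
    exact mul_le_mul_of_nonneg_left (hsJm p) (abs_nonneg _)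
  have hβmi : Integrable (fun p => |β p| * J p + |β p| * m p) σ := hβJi.add hβi
  have hβsi : Integrable (fun p => β p * s p) σ :=
    hβmi.mono' (hβ.mul hscont).aestronglyMeasurable (Eventually.of_forall hβs)
  refine ⟨f, ⟨hfsm.contMDiffOn, ?_, ?_, ?_, ?_, ?_, ?_⟩, ?_⟩
  · rw [hu']
    exact hsi.div_const Z
  · rw [hu', integral_div]
    exact div_self hZ.ne'
  · simp only [hu, ← mul_div_assoc]
    exact hDi.div_const Z
  · simp only [hu, ← mul_div_assoc]
    exact hPsi.div_const Z
  · simp only [hu, ← mul_div_assoc]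
    exact hfsi.div_const Z
  · simp only [hu, ← mul_div_assoc]
    exact hβsi.div_const Z
  -- The three summands bound, on the ball, the gradient term, the potential term and `s log s`.
  set a : ℝ := 4 * C ^ 2 + c + 4 with ha
  have hint1 : ∫ p, (r ^ 2 * (gradNorm n f p ^ 2 + P p) + f p - ((n : ℝ) + 1))
      * density n f (r ^ 2) p ∂μ ≤ L + (a * V + 9 * v) / Z := by
    have h1 : Integrable (fun p => (r ^ 2 * (gradNorm n f p ^ 2 + P p) + f p - ((n : ℝ) + 1))
        * density n f (r ^ 2) p) μ := by
      refine ((((hDi.add hPsi).const_mul (r ^ 2)).add hfsi).sub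
        (hsi.const_mul ((n : ℝ) + 1))).div_const Z |>.congr (Eventually.of_forall fun p => ?_)
      simp only [hu, Pi.add_apply, Pi.sub_apply]
      ring
    have hG1 : Integrable (fun p => L * s p + a * J p) μ :=
      (hsi.const_mul L).add (hJi.const_mul a)
    have hG2 : Integrable (fun p => (4 * r ^ 2 + 4) * m p + r ^ 2 * (|P p| * m p)) μ :=
      (hmi.const_mul _).add (hPi.const_mul _)
    calc _ ≤ ∫ p, ((L * s p + a * J p)
          + ((4 * r ^ 2 + 4) * m p + r ^ 2 * (|P p| * m p))) / Z ∂μ := by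
          refine integral_mono_ae h1 ((hG1.add hG2).div_const Z) ?_
          filter_upwards [hPs] with p hp
          rw [hu, ← mul_div_assoc]
          gcongr
          have h2 := (abs_le.1 (hslog p)).1
          have h3 : r ^ 2 * (P p * s p) ≤ r ^ 2 * (|P p| * s p) := by
            have := (hspos p).le
            gcongr
            exact le_abs_self _
          have h4 : 0 ≤ ((n : ℝ) + 1) * s p := mul_nonneg (by positivity) (hspos p).le
          have h5 : (r ^ 2 * (gradNorm n f p ^ 2 + P p) + f p - ((n : ℝ) + 1)) * s p
              = r ^ 2 * (gradNorm n f p ^ 2 * s p) + r ^ 2 * (P p * s p) + L * s p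
                - s p * Real.log (s p) - ((n : ℝ) + 1) * s p := by
            simp only [hf]
            ring
          rw [h5, ha]
          linarith [hgs p]
      _ = (L * Z + a * V + ((4 * r ^ 2 + 4) * ∫ p, m p ∂μ + r ^ 2 * ∫ p, |P p| * m p ∂μ)) / Z := by
          rw [integral_div, integral_add hG1 hG2,
            integral_add (hsi.const_mul L) (hJi.const_mul a),
            integral_add (hmi.const_mul _) (hPi.const_mul _), integral_const_mul,
            integral_const_mul, integral_const_mul, integral_const_mul, hJV]
      _ ≤ (L * Z + a * V + ((4 * r ^ 2 + 4) * κ + r ^ 2 * κ)) / Z := by gcongr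
      -- The weight contributes `5 r² κ + 4 κ ≤ 9v`; the boundary term later adds `2 r² κ ≤ 2v`,
      -- which gives the final 11.
      _ ≤ (L * Z + (a * V + 9 * v)) / Z := by
          refine div_le_div_of_nonneg_right ?_ hZ.le
          linarith
      _ = L + (a * V + 9 * v) / Z := by rw [add_div, mul_div_cancel_right₀ _ hZ.ne']
  have hint2 : ∫ p, β p * density n f (r ^ 2) p ∂σ ≤ (b + κ) / Z := by
    calc _ ≤ ∫ p, (|β p| * J p + |β p| * m p) / Z ∂σ := by
          refine integral_mono ?_ (hβmi.div_const Z) fun p => ?_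
          · simp only [hu, ← mul_div_assoc]
            exact hβsi.div_const Z
          · simp only [hu, ← mul_div_assoc]
            gcongr
            exact (le_abs_self _).trans (hβs p)
      _ ≤ (b + κ) / Z := by
          rw [integral_div, integral_add hβJi hβi, hβJb]
          gcongr
  have hLle : L ≤ Real.log (2 * V / r ^ (n + 1)) := by
    exact log_sub_log_le n hr hZ (by linarith)
  have hb0 : 0 ≤ b := ENNReal.toReal_nonneg
  have hV0 : 0 ≤ V := ENNReal.toReal_nonneg
  calc entropyFunctional n P β Ω f (r ^ 2)
      ≤ L + (a * V + 9 * v) / Z + 2 * r ^ 2 * ((b + κ) / Z) :=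
        add_le_add hint1 (mul_le_mul_of_nonneg_left hint2 (by positivity))
    _ = L + (a * V + 2 * r ^ 2 * b + (9 * v + 2 * (r ^ 2 * κ))) / Z := by ring
    _ ≤ L + (a * V + 2 * r ^ 2 * b + 11 * v) / v := by
        have ha0 : 0 ≤ a := by positivity
        gcongr
        linarith
    _ = L + (a * V + 2 * r ^ 2 * b) / v + 11 := by field_simp; ring
    _ ≤ _ := by gcongr

end Collapse

/-! ### Dependence on boundary data and passage to the limit -/

section Congruence

variable {n : ℕ} {X : Type*} [MetricSpace X] [MeasurableSpace X] [BorelSpace X]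
  [ChartedSpace (EuclideanSpace ℝ (Fin (n + 1))) X]
  [IsManifold (𝓡 (n + 1)) ∞ X] [RiemannianBundle (fun x : X => TangentSpace (𝓡 (n + 1)) x)]

theorem IsCompetitor.congr_boundary {P β β' : X → ℝ} {Ω : Set X} {τ : ℝ} {f : X → ℝ}
    (h : EqOn β β' (frontier Ω)) (hf : IsCompetitor n P β Ω τ f) : IsCompetitor n P β' Ω τ f where
  __ := hf
  integrable_boundary := hf.integrable_boundary.congr_fun
    (fun p hp => by simp only [h hp]) isClosed_frontier.measurableSet

theorem entropyFunctional_congr_boundary {P β β' : X → ℝ} {Ω : Set X}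
    (h : EqOn β β' (frontier Ω)) (f : X → ℝ) (τ : ℝ) :
    entropyFunctional n P β Ω f τ = entropyFunctional n P β' Ω f τ := by
  unfold entropyFunctional
  congr 2
  exact setIntegral_congr_fun isClosed_frontier.measurableSet fun p hp => by simp only [h hp]

end Congruence

section Collapse

variable {n : ℕ} {X : Type*} [MetricSpace X] [MeasurableSpace X] [BorelSpace X]
  [SecondCountableTopology X] [ChartedSpace (EuclideanSpace ℝ (Fin (n + 1))) X]
  [IsManifold (𝓡 (n + 1)) ∞ X] [RiemannianBundle (fun x : X => TangentSpace (𝓡 (n + 1)) x)]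
  [IsContMDiffRiemannianBundle (𝓡 (n + 1)) ∞ (EuclideanSpace ℝ (Fin (n + 1)))
      (fun x : X => TangentSpace (𝓡 (n + 1)) x)] [IsRiemannianManifold (𝓡 (n + 1)) X]

/-- Along a sequence of collapsing balls the entropy with a potential of scale-invariantly bounded
size is unbounded below. -/
theorem iInf_entropyWithPotential_eq_bot {Ω : Set X} (hΩ : IsOpen Ω) (hbdry : HasSmoothBoundary n Ω)
    {P β : X → ℝ} (hP : Continuous P) (hβ : ContinuousOn β (frontier Ω))
    {c₁ c : ℝ} {x : ℕ → X} {r : ℕ → ℝ} (hr : ∀ k, 0 < r k)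
    (hpos : ∀ k, 0 < (μHE[n + 1] : Measure X) (Ω ∩ Metric.ball (x k) (r k / 2)))
    (hratio : ∀ k,
      ((μHE[n + 1] : Measure X) (Ω ∩ Metric.ball (x k) (r k))
          + ENNReal.ofReal (r k ^ 2) *
            ∫⁻ y in frontier Ω ∩ Metric.ball (x k) (r k), ENNReal.ofReal |β y|
              ∂(μHE[n] : Measure X))
        / (μHE[n + 1] : Measure X) (Ω ∩ Metric.ball (x k) (r k / 2)) ≤ ENNReal.ofReal c₁)
    (hc : ∀ k, ∀ y ∈ Ω ∩ Metric.ball (x k) (r k), r k ^ 2 * |P y| ≤ c)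
    (hcollapse : Tendsto
      (fun k => (μHE[n + 1] : Measure X) (Ω ∩ Metric.ball (x k) (r k))
        / ENNReal.ofReal (r k ^ (n + 1))) atTop (𝓝 0)) :
    (⨅ (τ : ℝ) (_ : 0 < τ), entropyWithPotential n P β Ω τ) = ⊥ := by
  -- Tietze extension: the estimates use a coefficient continuous on all of `X`, while the
  -- functional only sees its values on `frontier Ω`.
  obtain ⟨β', hβ'⟩ := ContinuousMap.exists_restrict_eq (isClosed_frontier (s := Ω))
    ⟨(frontier Ω).domRestrict β, hβ.domRestrict⟩
  have hββ' : EqOn β β' (frontier Ω) := fun p hp =>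
    (congrArg (fun g : C(frontier Ω, ℝ) => g ⟨p, hp⟩) hβ').symm
  obtain ⟨C, hcut⟩ := exists_cutoff n
  -- The 6 is `4 + 2`, from `s log s` and from the factor 2 of the boundary integral. The maxima
  -- with 0 avoid sign assumptions on the constants and match `ENNReal.ofReal c₁`.
  set K : ℝ := (4 * C ^ 2 + max c 0 + 6) * max c₁ 0 + 11 with hK
  have hlim : Tendsto (fun k => Real.log (2 *
      ((μHE[n + 1] : Measure X) (Ω ∩ Metric.ball (x k) (r k))).toReal / r k ^ (n + 1)) + K)
      atTop atBot := by
    refine tendsto_atBot_add_const_right _ K (Real.tendsto_log_nhdsGT_zero.comp ?_)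
    have h1 := ((ENNReal.tendsto_toReal ENNReal.zero_ne_top).comp hcollapse).const_mul 2
    have h2 : (fun k => 2 * ((μHE[n + 1] : Measure X) (Ω ∩ Metric.ball (x k) (r k))).toReal
        / r k ^ (n + 1)) = fun k => 2 * (ENNReal.toReal ∘ fun k =>
          (μHE[n + 1] : Measure X) (Ω ∩ Metric.ball (x k) (r k))
            / ENNReal.ofReal (r k ^ (n + 1))) k := by
      ext k
      rw [Function.comp_apply, ENNReal.toReal_div,
        ENNReal.toReal_ofReal (pow_nonneg (hr k).le _), mul_div_assoc]
    rw [h2]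
    -- The limit must be from the right: `Real.log 0 = 0`, so positivity of the ratios is essential.
    -- It holds once the volumes are finite.
    refine tendsto_nhdsWithin_iff.2 ⟨by simpa using h1, ?_⟩
    filter_upwards [hcollapse.eventually_lt_const ENNReal.zero_lt_top] with k hk
    refine mul_pos two_pos (ENNReal.toReal_pos ?_ hk.ne)
    refine (ENNReal.div_pos ?_ ENNReal.ofReal_ne_top).ne'
    exact ((hpos k).trans_le (measure_mono (inter_subset_inter_right _
      (Metric.ball_subset_ball (by linarith [hr k]))))).ne'
  rw [EReal.eq_bot_iff_forall_lt]
  intro M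
  obtain ⟨k, hkM, hkV⟩ := ((hlim.eventually_lt_atBot M).and
    (hcollapse.eventually_lt_const ENNReal.zero_lt_top)).exists
  have hrk := hr k
  -- Finite volume comes from collapse: an infinite volume would make the quotient by `r k ^ (n +
  -- 1)` infinite.
  have hV : (μHE[n + 1] : Measure X) (Ω ∩ Metric.ball (x k) (r k)) < ⊤ := by
    rw [lt_top_iff_ne_top]
    intro h
    rw [h, ENNReal.top_div_of_ne_top ENNReal.ofReal_ne_top] at hkV
    exact lt_irrefl _ hkV
  have hvV : (μHE[n + 1] : Measure X) (Ω ∩ Metric.ball (x k) (r k / 2))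
      ≤ (μHE[n + 1] : Measure X) (Ω ∩ Metric.ball (x k) (r k)) :=
    measure_mono (inter_subset_inter_right _ (Metric.ball_subset_ball (by linarith)))
  have hv := hvV.trans_lt hV
  have hint : ∫⁻ y in frontier Ω ∩ Metric.ball (x k) (r k), ENNReal.ofReal |β y|
      ∂(μHE[n] : Measure X) = ∫⁻ y in frontier Ω ∩ Metric.ball (x k) (r k),
        ENNReal.ofReal |β' y| ∂(μHE[n] : Measure X) :=
    setLIntegral_congr_fun (isClosed_frontier.measurableSet.inter
      Metric.isOpen_ball.measurableSet) fun p hp => by simp only [hββ' hp.1]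
  have hle := (ENNReal.div_le_iff (hpos k).ne' hv.ne).1 (hratio k)
  rw [hint] at hle
  have hrhs : ENNReal.ofReal c₁ * (μHE[n + 1] : Measure X) (Ω ∩ Metric.ball (x k) (r k / 2)) < ⊤ :=
    ENNReal.mul_lt_top ENNReal.ofReal_lt_top hv
  -- The ratio bound, cleared of its finite nonzero denominator, also makes the boundary integral
  -- finite.
  have hbd : ∫⁻ y in frontier Ω ∩ Metric.ball (x k) (r k), ENNReal.ofReal |β' y|
      ∂(μHE[n] : Measure X) < ⊤ :=
    ENNReal.lt_top_of_mul_ne_top_right ((le_add_self.trans hle).trans_lt hrhs).ne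
      (ENNReal.ofReal_pos.2 (by positivity)).ne'
  obtain ⟨η, hη, hη1, hηin, hηout⟩ := hcut (x k) hrk
  obtain ⟨f, hf, hfW⟩ := exists_isCompetitor_le (c := max c 0) hΩ hbdry hP β'.continuous hrk (hpos k)
    hV hbd (fun y hy => (hc k y hy).trans (le_max_left _ _)) hη hη1 hηin hηout
  have hreal := ENNReal.toReal_mono hrhs.ne hle
  rw [ENNReal.toReal_add hV.ne (ENNReal.mul_lt_top ENNReal.ofReal_lt_top hbd).ne,
    ENNReal.toReal_mul, ENNReal.toReal_mul, ENNReal.toReal_ofReal (by positivity),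
    ENNReal.toReal_ofReal'] at hreal
  have hv0 := ENNReal.toReal_pos (hpos k).ne' hv.ne
  have hb0 : 0 ≤ (∫⁻ y in frontier Ω ∩ Metric.ball (x k) (r k), ENNReal.ofReal |β' y|
      ∂(μHE[n] : Measure X)).toReal := ENNReal.toReal_nonneg
  have hV0 : 0 ≤ ((μHE[n + 1] : Measure X) (Ω ∩ Metric.ball (x k) (r k))).toReal :=
    ENNReal.toReal_nonneg
  set V := ((μHE[n + 1] : Measure X) (Ω ∩ Metric.ball (x k) (r k))).toReal
  set v := ((μHE[n + 1] : Measure X) (Ω ∩ Metric.ball (x k) (r k / 2))).toReal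
  set b := (∫⁻ y in frontier Ω ∩ Metric.ball (x k) (r k), ENNReal.ofReal |β' y|
      ∂(μHE[n] : Measure X)).toReal
  have hquot : ((4 * C ^ 2 + max c 0 + 4) * V + 2 * r k ^ 2 * b) / v
      ≤ (4 * C ^ 2 + max c 0 + 6) * max c₁ 0 := by
    have hc0 : 0 ≤ max c 0 := le_max_right _ _
    rw [div_le_iff₀ hv0, mul_assoc (4 * C ^ 2 + max c 0 + 6)]
    calc (4 * C ^ 2 + max c 0 + 4) * V + 2 * r k ^ 2 * b
        ≤ (4 * C ^ 2 + max c 0 + 6) * (V + r k ^ 2 * b) := by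
          have : 0 ≤ (4 * C ^ 2 + max c 0 + 4) * (r k ^ 2 * b) := by positivity
          linarith
      _ ≤ _ := by gcongr
  have hfM : entropyFunctional n P β Ω f (r k ^ 2) < M := by
    rw [entropyFunctional_congr_boundary hββ']
    linarith
  have hfβ : IsCompetitor n P β Ω (r k ^ 2) f := hf.congr_boundary hββ'.symm
  calc (⨅ (τ : ℝ) (_ : 0 < τ), entropyWithPotential n P β Ω τ)
      ≤ entropyWithPotential n P β Ω (r k ^ 2) := iInf₂_le _ (by positivity)
    _ ≤ (entropyFunctional n P β Ω f (r k ^ 2) : EReal) := iInf₂_le f hfβ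
    _ < M := EReal.coe_lt_coe_iff.2 hfM

end Collapse

end RegionEntropy

end

/-! ### The potentials `R` and `0` -/

theorem mainTheorem11 (n : ℕ) {X : Type*} [MetricSpace X] [SecondCountableTopology X]
    [MeasurableSpace X] [BorelSpace X]
    [ChartedSpace (EuclideanSpace ℝ (Fin (n + 1))) X] [IsManifold (𝓡 (n + 1)) ∞ X]
    [RiemannianBundle (fun x : X => TangentSpace (𝓡 (n + 1)) x)]
    [IsContMDiffRiemannianBundle (𝓡 (n + 1)) ∞ (EuclideanSpace ℝ (Fin (n + 1)))
      (fun x : X => TangentSpace (𝓡 (n + 1)) x)]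
    [IsRiemannianManifold (𝓡 (n + 1)) X] [CompleteSpace X]
    (Ω : Set X) (hΩ : IsOpen Ω) (hbdry : RegionEntropy.HasSmoothBoundary n Ω)
    (β : X → ℝ) (hβ : ContMDiffOn (𝓡 (n + 1)) 𝓘(ℝ, ℝ) ∞ β (frontier Ω))
    (c₁ c₂ : ℝ) (x : ℕ → X) (r : ℕ → ℝ) (hr : ∀ k, 0 < r k)
    (hpos : ∀ k, 0 < (μHE[n + 1] : Measure X) (Ω ∩ Metric.ball (x k) (r k / 2)))
    (hratio : ∀ k,
      ((μHE[n + 1] : Measure X) (Ω ∩ Metric.ball (x k) (r k))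
          + ENNReal.ofReal (r k ^ 2) *
            ∫⁻ y in frontier Ω ∩ Metric.ball (x k) (r k), ENNReal.ofReal |β y|
              ∂(μHE[n] : Measure X))
        / (μHE[n + 1] : Measure X) (Ω ∩ Metric.ball (x k) (r k / 2)) ≤ ENNReal.ofReal c₁)
    (hcurv : ∀ k, ∀ y ∈ Ω ∩ Metric.ball (x k) (r k),
      r k ^ 2 * RegionEntropy.riemannNorm n y ≤ c₂)
    (hcollapse : Tendsto
      (fun k => (μHE[n + 1] : Measure X) (Ω ∩ Metric.ball (x k) (r k))
        / ENNReal.ofReal (r k ^ (n + 1))) atTop (𝓝 0)) :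
    (⨅ (τ : ℝ) (_ : 0 < τ), RegionEntropy.metricEntropy n β Ω τ) = ⊥ ∧
      (⨅ (τ : ℝ) (_ : 0 < τ), RegionEntropy.entropy n β Ω τ) = ⊥ := by
  refine ⟨RegionEntropy.iInf_entropyWithPotential_eq_bot (c := ((n : ℝ) + 1) ^ 2 * c₂) hΩ hbdry
    RegionEntropy.continuous_scalarCurvature hβ.continuousOn hr hpos hratio (fun k y hy => ?_)
    hcollapse, RegionEntropy.iInf_entropyWithPotential_eq_bot (c := 0) hΩ hbdry continuous_const
    hβ.continuousOn hr hpos hratio (fun k y hy => by simp) hcollapse⟩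
  calc r k ^ 2 * |RegionEntropy.scalarCurvature n y|
      ≤ r k ^ 2 * (((n : ℝ) + 1) ^ 2 * RegionEntropy.riemannNorm n y) := by
        gcongr
        exact RegionEntropy.abs_scalarCurvature_le y
    _ = ((n : ℝ) + 1) ^ 2 * (r k ^ 2 * RegionEntropy.riemannNorm n y) := by ring
    _ ≤ ((n : ℝ) + 1) ^ 2 * c₂ := by
        gcongr
        exact hcurv k y hy
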